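/- Let $M$ be a (finite-dimensional) complex manifold endowed with a holomorphic Riemannian metric $\langle\cdot,\cdot\rangle$, and let $L$ be a holomorphic line bundle over $M$ endowed with a holomorphic connection with curvature form $\Omega$, that is, $\Omega(X,Y)s=\nabla^L_X\nabla^L_Ys-\nabla^L_Y\nabla^L_Xs-\nabla^L_{[X,Y]}s$. Let $E=T(L\setminus0)/(\mathbb{C}\setminus\{0\})$ be the vector bundle over $M$ whose sections are the vector fields on $L\setminus0$ invariant under the action of $\mathbb{C}\setminus\{0\}$, let $\rho:E\to TM$ be the projection (induced by the differential of $L\setminus0\to M$), and endow the sections of $E$ with the bracket $[\cdot,\cdot]$ of invariant vector fields. Let $u$ be a nowhere zero holomorphic function on $M$, and let $\mathbf{1}$ be the section of $E$ such that $u\mathbf{1}$ is the infinitesimal generator of the action of $\mathbb{C}\setminus\{0\}$ on $L$. By using horizontal lifts with respect to the connection of $L$, regard $TM$ as a subbundle of $E$, so that $E=TM\oplus\mathbb{C}\mathbf{1}$. A $\rho$-connection on a vector bundle $W$ over $M$ associates to sections $e$ of $E$ and $\sigma$ of $W$ a section $\nabla_e\sigma$ of $W$, linear over functions in $e$, additive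 in $\sigma$, and such that $\nabla_e(f\sigma)=f\nabla_e\sigma+\rho(e)(f)\,\sigma$, for any function $f$ on $M$. Let $\nabla$ be a $\rho$-connection on $TM$, $\gamma$ a section of $\mathrm{Hom}(E,TM)$, $h$ a section of $\mathrm{Hom}(TM,\mathrm{End}(TM))$, and let $\widetilde\nabla$ be a $\rho$-connection on $E$ such that, for any local vector fields $X$ and $Y$ on $M$, \begin{align*} \widetilde\nabla_XY&=\nabla_XY+h(\gamma(X))Y-\langle\gamma(X),Y\rangle\mathbf{1},& \widetilde\nabla_X\mathbf{1}&=\gamma(X),\\ \widetilde\nabla_{\mathbf{1}}X&=\nabla_{\mathbf{1}}X+h(\gamma(\mathbf{1}))X-\langle\gamma(\mathbf{1}),X\rangle\mathbf{1},& \widetilde\nabla_{\mathbf{1}}\mathbf{1}&=\gamma(\mathbf{1}). \end{align*} Then the torsion $\widetilde T(a,b)=\widetilde\nabla_ab-\widetilde\nabla_ba-[a,b]$ of $\widetilde\nabla$ is given by \begin{align*} \widetilde T(X,Y)&=T(X,Y)+h(\gamma(X))Y-h(\gamma(Y))X+\bigl(u\,\Omega(X,Y)-\langle\gamma(X),Y\rangle+\langle\gamma(Y),X\rangle\bigr)\mathbf{1},\\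 \widetilde T(X,\mathbf{1})&=\gamma(X)-\nabla_{\mathbf{1}}X-h(\gamma(\mathbf{1}))X+\bigl(u^{-1}X(u)+\langle\gamma(\mathbf{1}),X\rangle\bigr)\mathbf{1}, \end{align*} for any local vector fields $X$ and $Y$ on $M$, where $T$ is the torsion of the connection on $M$ obtained by restricting $\nabla$ to $TM\subseteq E$. -/

import Mathlib

open Bundle Set
open scoped Manifold ContDiff Topology

noncomputable section

namespace LineBundleAtiyah

section Setting

/- `M` is a complex manifold modelled on the finite-dimensional complex vector space `V`,
and `L` is a holomorphic line bundle over `M`. -/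
variable {V : Type*} [NormedAddCommGroup V] [NormedSpace ℂ V]
  {M : Type*} [TopologicalSpace M] [ChartedSpace V M] [IsManifold 𝓘(ℂ, V) ω M]
  {L : M → Type*} [TopologicalSpace (TotalSpace ℂ L)]
  [∀ x, AddCommGroup (L x)] [∀ x, Module ℂ (L x)] [∀ x, TopologicalSpace (L x)]
  [∀ x, IsTopologicalAddGroup (L x)] [∀ x, ContinuousSMul ℂ (L x)]
  [FiberBundle ℂ L] [VectorBundle ℂ ℂ L] [ContMDiffVectorBundle ω ℂ L 𝓘(ℂ, V)]

variable (V) in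
/-- The tangent space at `l ∈ L x` of the total space of the line bundle `L`. -/
abbrev TotTangent (x : M) (l : L x) : Type _ :=
  TangentSpace (𝓘(ℂ, V).prod 𝓘(ℂ, ℂ)) (TotalSpace.mk x l : TotalSpace ℂ L)

/-- The action of a scalar on the total space of `L`. -/
def scale (a : ℂ) (p : TotalSpace ℂ L) : TotalSpace ℂ L := TotalSpace.mk p.1 (a • p.2)

variable (V) in
/-- The differential at `l` of the action of a scalar on the total space of `L`. -/
def dscale (a : ℂ) (x : M) (l : L x) : TotTangent V x l →L[ℂ] TotTangent V x (a • l) :=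
  mfderiv (𝓘(ℂ, V).prod 𝓘(ℂ, ℂ)) (𝓘(ℂ, V).prod 𝓘(ℂ, ℂ)) (scale (L := L) a) (TotalSpace.mk x l)

variable (V L) in
/-- The fibre at `x` of the vector bundle `E = T(L \ 0) / (ℂ \ {0})`: the vector fields on `L \ 0`,
along the fibre `L x \ {0}` (which is an orbit of `ℂ \ {0}`), that are invariant under the action of
`ℂ \ {0}`. Thus, sections of `E` are the invariant vector fields on `L \ 0`. -/
def AtiyahFiber (x : M) :
    Submodule ℂ (∀ l : {l : L x // l ≠ 0}, TotTangent V x (l : L x)) where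
  carrier := {Z | ∀ (a : ℂˣ) (l : {l : L x // l ≠ 0}),
    dscale V (a : ℂ) x (l : L x) (Z l) = Z ⟨(a : ℂ) • (l : L x), smul_ne_zero a.ne_zero l.2⟩}
  add_mem' := fun {Z W} hZ hW a l ↦ by
    simp only [mem_ofPred_eq] at hZ hW
    simp [hZ a l, hW a l]
  zero_mem' := fun a l ↦ by simp
  smul_mem' := fun c Z hZ a l ↦ by
    simp only [mem_ofPred_eq] at hZ
    simp [hZ a l]

variable (V L) in
/-- The space of (not necessarily regular) sections of `E`. -/
abbrev AtiyahSection : Type _ := ∀ x : M, AtiyahFiber V L x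

open Classical in
/-- The vector field on `L \ 0` given by a section of `E` (with the junk value `0` along the zero
section of `L`). -/
def toField (s : AtiyahSection V L) (p : TotalSpace ℂ L) :
    TangentSpace (𝓘(ℂ, V).prod 𝓘(ℂ, ℂ)) p :=
  if hp : p.2 ≠ 0 then (s p.1).1 ⟨p.2, hp⟩ else 0

/-- A section of `E` is differentiable at `x` if the corresponding invariant vector field on `L \ 0`
is differentiable at the points over `x`. -/
def AtiyahSection.DiffAt (s : AtiyahSection V L) (x : M) : Prop :=
  ∀ l : L x, l ≠ 0 → MDifferentiableAt (𝓘(ℂ, V).prod 𝓘(ℂ, ℂ)) (𝓘(ℂ, V).prod 𝓘(ℂ, ℂ)).tangent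
    (fun p : TotalSpace ℂ L ↦
      (⟨p, toField s p⟩ : TangentBundle (𝓘(ℂ, V).prod 𝓘(ℂ, ℂ)) (TotalSpace ℂ L)))
    (TotalSpace.mk x l)

open Classical in
/-- The bracket of two sections of `E` is the Lie bracket of the corresponding invariant vector
fields on `L \ 0`. (The latter is invariant if the sections are differentiable, see
`dscale_mlieBracket`; the value is `0` otherwise.) -/
def atiyahBracket (s t : AtiyahSection V L) : AtiyahSection V L := fun x ↦
  if hst : (fun l : {l : L x // l ≠ 0} ↦ (VectorField.mlieBracket (𝓘(ℂ, V).prod 𝓘(ℂ, ℂ))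
      (toField s) (toField t) (TotalSpace.mk x (l : L x)) : TotTangent V x (l : L x)))
      ∈ AtiyahFiber V L x
  then ⟨_, hst⟩ else 0

/-- The coordinate on the fibre `L x` given by the preferred trivialization at `x`. -/
def fiberCoord (x : M) : L x ≃L[ℂ] ℂ :=
  (trivializationAt ℂ L x).continuousLinearEquivAt ℂ x (FiberBundle.mem_baseSet_trivializationAt' x)

/-- A nonzero point of `L x`. -/
def basePoint (x : M) : {l : L x // l ≠ 0} :=
  ⟨(fiberCoord x).symm 1, by simp⟩

/-- The projection `ρ : E → TM`, induced by the differential of the projection `L \ 0 → M`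
(it does not depend on the point of `L x \ {0}` at which it is computed, see `anchor_eq`). -/
def anchor (x : M) : AtiyahFiber V L x →ₗ[ℂ] TangentSpace 𝓘(ℂ, V) x :=
  (mfderiv (𝓘(ℂ, V).prod 𝓘(ℂ, ℂ)) 𝓘(ℂ, V) (TotalSpace.proj : TotalSpace ℂ L → M)
    (TotalSpace.mk x (basePoint (L := L) x : L x))).toLinearMap ∘ₗ
  (LinearMap.proj (R := ℂ) (φ := fun l : {l : L x // l ≠ 0} ↦ TotTangent V x (l : L x))
    (basePoint (L := L) x)) ∘ₗ (AtiyahFiber V L x).subtype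

variable (V) in
/-- The vertical lift at `l` of `v ∈ L x`: the velocity at `0` of the curve `t ↦ l + t v`, computed
with the help of the linear coordinate on `L x`. -/
def verticalLift (x : M) (l : L x) : L x →L[ℂ] TotTangent V x l :=
  ContinuousLinearMap.comp (M₂ := ℂ)
    (mfderiv 𝓘(ℂ, ℂ) (𝓘(ℂ, V).prod 𝓘(ℂ, ℂ))
      (fun z : ℂ ↦ (TotalSpace.mk x (l + (fiberCoord x).symm z) : TotalSpace ℂ L)) 0)
    (fiberCoord (L := L) x).toContinuousLinearMap

variable (V) in
/-- The infinitesimal generator of the action of `ℂ \ {0}` on `L`, at the point `l`: the velocity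
at `0` of the curve `t ↦ exp t • l`. -/
def generatorAt (x : M) (l : L x) : TotTangent V x l :=
  mfderiv 𝓘(ℂ, ℂ) (𝓘(ℂ, V).prod 𝓘(ℂ, ℂ))
    (fun t : ℂ ↦ (TotalSpace.mk x (Complex.exp t • l) : TotalSpace ℂ L)) 0 (1 : ℂ)

/-- A local section of `L` (constant in the preferred trivialization at `x`, and `0` outside its
domain) whose value at `x` is `l`. -/
def localSection (x : M) (l : L x) (y : M) : L y :=
  (trivializationAt ℂ L x).symmL ℂ y (fiberCoord x l)

variable (V) in
/-- The differential at `x` of `localSection x l`. -/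
def dLocalSection (x : M) (l : L x) : TangentSpace 𝓘(ℂ, V) x →L[ℂ] TotTangent V x l :=
  mfderiv 𝓘(ℂ, V) (𝓘(ℂ, V).prod 𝓘(ℂ, ℂ))
    (fun y : M ↦ (TotalSpace.mk y (localSection x l y) : TotalSpace ℂ L)) x

/-- The horizontal lift at `l` of `X ∈ T_x M`, with respect to the connection `D` on `L`:
`ds(X)` minus the vertical lift of `D_X s`, where `s` is a local section of `L` with `s(x) = l`
(the result does not depend on the choice of `s`). -/
def horizontalLiftAt (D : CovariantDerivative 𝓘(ℂ, V) ℂ L) (x : M) (l : L x) :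
    TangentSpace 𝓘(ℂ, V) x →L[ℂ] TotTangent V x l :=
  dLocalSection V x l - verticalLift V x l ∘L D (localSection x l) x

lemma contMDiff_scale (a : ℂ) :
    ContMDiff (𝓘(ℂ, V).prod 𝓘(ℂ, ℂ)) (𝓘(ℂ, V).prod 𝓘(ℂ, ℂ)) ω (scale (L := L) a) := by
  intro p
  have hid : ContMDiffAt (𝓘(ℂ, V).prod 𝓘(ℂ, ℂ)) (𝓘(ℂ, V).prod 𝓘(ℂ, ℂ)) ω
    (fun q : TotalSpace ℂ L ↦ q) p := contMDiffAt_id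
  rw [Bundle.contMDiffAt_totalSpace] at hid ⊢
  refine ⟨hid.1, ?_⟩
  have h2 := (contMDiffAt_const (c := a)).mul hid.2
  refine h2.congr_of_eventuallyEq ?_
  have hopen : TotalSpace.proj ⁻¹' (trivializationAt ℂ L p.1).baseSet ∈ 𝓝 p :=
    ((trivializationAt ℂ L p.1).open_baseSet.preimage
      (FiberBundle.continuous_proj ℂ L)).mem_nhds (FiberBundle.mem_baseSet_trivializationAt' p.1)
  filter_upwards [hopen] with q hq
  have := ((trivializationAt ℂ L p.1).linear ℂ hq).map_smul a q.2
  simpa [scale] using this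

lemma hasMFDerivAt_scale (a : ℂ) (x : M) (l : L x) (p : TotalSpace ℂ L)
    (hp : p = TotalSpace.mk x l) :
    HasMFDerivAt (𝓘(ℂ, V).prod 𝓘(ℂ, ℂ)) (𝓘(ℂ, V).prod 𝓘(ℂ, ℂ)) (scale (L := L) a) p
      (dscale V a x l : V × ℂ →L[ℂ] V × ℂ) := by
  subst hp
  exact ((contMDiff_scale a _).mdifferentiableAt (by simp)).hasMFDerivAt

lemma mdifferentiableAt_fiberCurve (x : M) (f : ℂ → L x) (z : ℂ)
    (hf : DifferentiableAt ℂ (fun w ↦ fiberCoord x (f w)) z) :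
    MDifferentiableAt 𝓘(ℂ, ℂ) (𝓘(ℂ, V).prod 𝓘(ℂ, ℂ))
      (fun w : ℂ ↦ (TotalSpace.mk x (f w) : TotalSpace ℂ L)) z := by
  rw [mdifferentiableAt_totalSpace]
  exact ⟨mdifferentiableAt_const, hf.mdifferentiableAt⟩

lemma dscale_generatorAt (a : ℂ) (x : M) (l : L x) :
    dscale V a x l (generatorAt V x l) = generatorAt V x (a • l) := by
  have hc : MDifferentiableAt 𝓘(ℂ, ℂ) (𝓘(ℂ, V).prod 𝓘(ℂ, ℂ))
      (fun t : ℂ ↦ (TotalSpace.mk x (Complex.exp t • l) : TotalSpace ℂ L)) 0 := by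
    apply mdifferentiableAt_fiberCurve
    simp only [map_smul, smul_eq_mul]
    fun_prop
  have hcomp := HasMFDerivAt.comp (0 : ℂ) (hasMFDerivAt_scale (V := V) a x l _ (by simp))
    hc.hasMFDerivAt
  have hfun : scale (L := L) a ∘ (fun t : ℂ ↦ (TotalSpace.mk x (Complex.exp t • l) : TotalSpace ℂ L))
      = fun t : ℂ ↦ TotalSpace.mk x (Complex.exp t • a • l) := by
    funext t
    simp [scale, smul_comm a]
  rw [hfun] at hcomp
  exact (congrArg (fun f : ℂ →L[ℂ] V × ℂ ↦ f 1) hcomp.mfderiv).symm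

lemma verticalLift_apply (x : M) (l v : L x) :
    verticalLift V x l v = (show ℂ →L[ℂ] V × ℂ from mfderiv 𝓘(ℂ, ℂ) (𝓘(ℂ, V).prod 𝓘(ℂ, ℂ))
      (fun z : ℂ ↦ (TotalSpace.mk x (l + (fiberCoord x).symm z) : TotalSpace ℂ L)) 0)
        (fiberCoord x v) := rfl

lemma dscale_verticalLift (a : ℂ) (x : M) (l v : L x) :
    dscale V a x l (verticalLift V x l v) = verticalLift V x (a • l) (a • v) := by
  have hc (l : L x) (w : ℂ) : MDifferentiableAt 𝓘(ℂ, ℂ) (𝓘(ℂ, V).prod 𝓘(ℂ, ℂ))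
      (fun z : ℂ ↦ (TotalSpace.mk x (l + (fiberCoord x).symm z) : TotalSpace ℂ L)) w := by
    apply mdifferentiableAt_fiberCurve
    simp only [map_add, ContinuousLinearEquiv.apply_symm_apply]
    fun_prop
  have hcomp := HasMFDerivAt.comp (0 : ℂ) (hasMFDerivAt_scale (V := V) a x l _ (by simp))
    (hc l 0).hasMFDerivAt
  have hm : HasMFDerivAt 𝓘(ℂ, ℂ) 𝓘(ℂ, ℂ) (fun z : ℂ ↦ a * z) 0
      (show ℂ →L[ℂ] ℂ from a • ContinuousLinearMap.id ℂ ℂ) :=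
    ((hasFDerivAt_id (0 : ℂ)).const_mul a).hasMFDerivAt
  have hv : ∀ w : ℂ, w = 0 → HasMFDerivAt 𝓘(ℂ, ℂ) (𝓘(ℂ, V).prod 𝓘(ℂ, ℂ))
      (fun z : ℂ ↦ (TotalSpace.mk x (a • l + (fiberCoord x).symm z) : TotalSpace ℂ L)) w
      (show ℂ →L[ℂ] V × ℂ from mfderiv 𝓘(ℂ, ℂ) (𝓘(ℂ, V).prod 𝓘(ℂ, ℂ))
      (fun z : ℂ ↦ (TotalSpace.mk x (a • l + (fiberCoord x).symm z) : TotalSpace ℂ L)) 0) := by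
    intro w hw
    subst hw
    exact (hc _ _).hasMFDerivAt
  have hcomp' := HasMFDerivAt.comp (0 : ℂ) (hv (a * 0) (mul_zero a)) hm
  have hfun : scale (L := L) a ∘
      (fun z : ℂ ↦ (TotalSpace.mk x (l + (fiberCoord x).symm z) : TotalSpace ℂ L))
      = (fun z : ℂ ↦ (TotalSpace.mk x (a • l + (fiberCoord x).symm z) : TotalSpace ℂ L)) ∘
        (fun z : ℂ ↦ a * z) := by
    funext z
    simp only [scale, Function.comp_apply, smul_add]
    rw [← smul_eq_mul a z, map_smul]
  rw [hfun] at hcomp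
  have h1 := hasMFDerivAt_unique hcomp hcomp'
  have h3 : (a • ContinuousLinearMap.id ℂ ℂ) (fiberCoord x v) = fiberCoord x (a • v) := by simp
  have h2 := congrArg (fun f : ℂ →L[ℂ] V × ℂ ↦ f (fiberCoord x v)) h1
  rw [verticalLift_apply, verticalLift_apply, ← h3]
  exact h2

lemma localSection_self (x : M) (l : L x) : localSection x l x = l := by
  have hx : x ∈ (trivializationAt ℂ L x).baseSet := FiberBundle.mem_baseSet_trivializationAt' x
  have h1 := (fiberCoord x).symm_apply_apply l
  rwa [fiberCoord, Trivialization.symm_continuousLinearEquivAt_eq] at h1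

lemma localSection_smul (a : ℂ) (x : M) (l : L x) :
    localSection x (a • l) = a • localSection x l := by
  funext y
  rw [Pi.smul_apply, localSection, localSection, map_smul, map_smul]

lemma mdifferentiableAt_localSection (x : M) (l : L x) :
    MDifferentiableAt 𝓘(ℂ, V) (𝓘(ℂ, V).prod 𝓘(ℂ, ℂ))
      (fun y : M ↦ (TotalSpace.mk y (localSection x l y) : TotalSpace ℂ L)) x := by
  refine (FiberBundle.mdifferentiableAt_extend 𝓘(ℂ, V) ℂ l).congr_of_eventuallyEq ?_
  filter_upwards [(trivializationAt ℂ L x).open_baseSet.mem_nhds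
    (FiberBundle.mem_baseSet_trivializationAt' x)] with y hy
  have h1 : localSection x l y = FiberBundle.extend ℂ l y :=
    Trivialization.symmL_apply _ hy _
  rw [h1]

lemma dscale_horizontalLiftAt (D : CovariantDerivative 𝓘(ℂ, V) ℂ L) (a : ℂ) (x : M) (l : L x)
    (X : TangentSpace 𝓘(ℂ, V) x) :
    dscale V a x l (horizontalLiftAt D x l X) = horizontalLiftAt D x (a • l) X := by
  have hcomp := HasMFDerivAt.comp x (hasMFDerivAt_scale (V := V) a x l _
    (by rw [localSection_self])) (mdifferentiableAt_localSection (V := V) x l).hasMFDerivAt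
  have hfun : scale (L := L) a ∘
      (fun y : M ↦ (TotalSpace.mk y (localSection x l y) : TotalSpace ℂ L))
      = fun y : M ↦ TotalSpace.mk y (localSection x (a • l) y) := by
    rw [localSection_smul]
    rfl
  rw [hfun] at hcomp
  have h1 := congrArg (fun f : V →L[ℂ] V × ℂ ↦ f X) hcomp.mfderiv
  have h2 : D (localSection x (a • l)) x = a • D (localSection x l) x := by
    rw [localSection_smul]
    exact D.isCovariantDerivativeOnUniv.smul_const a (mdifferentiableAt_localSection x l)
  have h3 := dscale_verticalLift (V := V) a x l (D (localSection x l) x X)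
  have h4 := map_sub (dscale V a x l)
    (dLocalSection V x l X)
    (verticalLift V x l (D (localSection x l) x X))
  refine Eq.trans h4 ?_
  have h5 : a • D (localSection x l) x X = D (localSection x (a • l)) x X := by
    rw [h2]; rfl
  rw [h3, h5]
  exact congrArg (fun w : V × ℂ ↦ w -
    (show V × ℂ from verticalLift V x (a • l) (D (localSection x (a • l)) x X))) h1.symm

lemma hasMFDerivAt_proj (x : M) (l : L x) (p : TotalSpace ℂ L)
    (hp : p = TotalSpace.mk x l) :
    HasMFDerivAt (𝓘(ℂ, V).prod 𝓘(ℂ, ℂ)) 𝓘(ℂ, V) (TotalSpace.proj : TotalSpace ℂ L → M) p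
      (show V × ℂ →L[ℂ] V from mfderiv (𝓘(ℂ, V).prod 𝓘(ℂ, ℂ)) 𝓘(ℂ, V)
        (TotalSpace.proj : TotalSpace ℂ L → M) (TotalSpace.mk x l)) := by
  subst hp
  exact ((Bundle.contMDiff_proj (n := ω) L _).mdifferentiableAt (by simp)).hasMFDerivAt

lemma dproj_verticalLift (x : M) (l v : L x) :
    mfderiv (𝓘(ℂ, V).prod 𝓘(ℂ, ℂ)) 𝓘(ℂ, V) (TotalSpace.proj : TotalSpace ℂ L → M)
      (TotalSpace.mk x l) (verticalLift V x l v) = 0 := by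
  have hc : MDifferentiableAt 𝓘(ℂ, ℂ) (𝓘(ℂ, V).prod 𝓘(ℂ, ℂ))
      (fun z : ℂ ↦ (TotalSpace.mk x (l + (fiberCoord x).symm z) : TotalSpace ℂ L)) 0 := by
    apply mdifferentiableAt_fiberCurve
    simp only [map_add, ContinuousLinearEquiv.apply_symm_apply]
    fun_prop
  have hcomp := HasMFDerivAt.comp (0 : ℂ) (hasMFDerivAt_proj (V := V) x l _ (by simp))
    hc.hasMFDerivAt
  have h1 := hcomp.mfderiv.symm.trans (hasMFDerivAt_const (I := 𝓘(ℂ, ℂ)) x (0 : ℂ)).mfderiv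
  exact congrArg (fun f : ℂ →L[ℂ] V ↦ f (fiberCoord x v)) h1

lemma dproj_horizontalLiftAt (D : CovariantDerivative 𝓘(ℂ, V) ℂ L) (x : M) (l : L x)
    (X : TangentSpace 𝓘(ℂ, V) x) :
    mfderiv (𝓘(ℂ, V).prod 𝓘(ℂ, ℂ)) 𝓘(ℂ, V) (TotalSpace.proj : TotalSpace ℂ L → M)
      (TotalSpace.mk x l) (horizontalLiftAt D x l X) = X := by
  have hcomp := HasMFDerivAt.comp x (hasMFDerivAt_proj (V := V) x l _
    (by rw [localSection_self])) (mdifferentiableAt_localSection (V := V) x l).hasMFDerivAt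
  have h1 := hcomp.mfderiv.symm.trans (hasMFDerivAt_id (I := 𝓘(ℂ, V)) x).mfderiv
  have h2 := congrArg (fun f : V →L[ℂ] V ↦ f X) h1
  have h4 := map_sub (mfderiv (𝓘(ℂ, V).prod 𝓘(ℂ, ℂ)) 𝓘(ℂ, V)
      (TotalSpace.proj : TotalSpace ℂ L → M) (TotalSpace.mk x l))
    (dLocalSection V x l X)
    (verticalLift V x l (D (localSection x l) x X))
  refine Eq.trans h4 ?_
  rw [dproj_verticalLift]
  refine Eq.trans (sub_zero _) ?_
  exact h2

lemma anchor_eq (x : M) (Z : AtiyahFiber V L x) (l : {l : L x // l ≠ 0}) :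
    anchor x Z = mfderiv (𝓘(ℂ, V).prod 𝓘(ℂ, ℂ)) 𝓘(ℂ, V) (TotalSpace.proj : TotalSpace ℂ L → M)
      (TotalSpace.mk x (l : L x)) (Z.1 l) := by
  obtain ⟨l, hl⟩ := l
  have hcl : fiberCoord x l ≠ 0 := by simpa using hl
  obtain ⟨a, ha⟩ : ∃ a : ℂˣ, (a : ℂ) • ((basePoint x).1 : L x) = l :=
    ⟨Units.mk0 _ hcl, by simp [basePoint, ← map_smul]⟩
  subst ha
  have hZ := Z.2 a (basePoint x)
  rw [← hZ]
  have hcomp := HasMFDerivAt.comp (TotalSpace.mk x (basePoint (L := L) x).1)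
    (hasMFDerivAt_proj (V := V) x ((a : ℂ) • (basePoint (L := L) x).1) _ rfl)
    (hasMFDerivAt_scale (V := V) (a : ℂ) x (basePoint (L := L) x).1 _ rfl)
  exact congrArg (fun f : V × ℂ →L[ℂ] V ↦ f (Z.1 (basePoint x))) hcomp.mfderiv

lemma toField_scale (s : AtiyahSection V L) (a : ℂˣ) (p : TotalSpace ℂ L) :
    dscale V (a : ℂ) p.1 p.2 (toField s p) = toField s (scale (a : ℂ) p) := by
  by_cases hp : p.2 = 0
  · have h1 : toField s p = 0 := dif_neg (by simpa using hp)
    have h2 : toField s (scale (a : ℂ) p) = 0 := dif_neg (by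
      rw [not_not]
      exact (congrArg (fun v : L p.1 ↦ (a : ℂ) • v) hp).trans (smul_zero (A := L p.1) (a : ℂ)))
    rw [h1, h2]
    exact map_zero _
  · have hp' : (scale (a : ℂ) p).2 ≠ 0 := smul_ne_zero a.ne_zero hp
    have h1 : toField s p = (s p.1).1 ⟨p.2, hp⟩ := dif_pos hp
    have h2 : toField s (scale (a : ℂ) p) = (s p.1).1 ⟨(a : ℂ) • p.2, hp'⟩ := dif_pos hp'
    rw [h1, h2]
    exact (s p.1).2 a ⟨p.2, hp⟩

lemma scale_inv_scale (a : ℂˣ) (p : TotalSpace ℂ L) :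
    scale ((a⁻¹ : ℂˣ) : ℂ) (scale (a : ℂ) p) = p := by
  have h : ((a⁻¹ : ℂˣ) : ℂ) • (a : ℂ) • p.2 = p.2 := by
    rw [smul_smul, Units.inv_mul, one_smul]
  exact congrArg (fun v ↦ (TotalSpace.mk p.1 v : TotalSpace ℂ L)) h

lemma isInvertible_dscale (a : ℂˣ) (x : M) (l : L x) :
    (dscale V (a : ℂ) x l).IsInvertible := by
  have h (b : ℂˣ) (m : L x) (p : TotalSpace ℂ L) (hp : p = TotalSpace.mk x m) :=
    hasMFDerivAt_scale (V := V) (b : ℂ) x m p hp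
  have hid (b : ℂˣ) : scale (L := L) ((b⁻¹ : ℂˣ) : ℂ) ∘ scale (L := L) (b : ℂ) = id :=
    funext fun p ↦ scale_inv_scale b p
  have h1 := HasMFDerivAt.comp (TotalSpace.mk x l) (h a⁻¹ ((a : ℂ) • l) _ rfl) (h a l _ rfl)
  have h2 := HasMFDerivAt.comp (TotalSpace.mk x ((a : ℂ) • l))
    (h a l _ (scale_inv_scale a (TotalSpace.mk x l))) (h a⁻¹ ((a : ℂ) • l) _ rfl)
  rw [hid a] at h1
  have hid' := hid a⁻¹
  rw [inv_inv] at hid'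
  rw [hid'] at h2
  have k1 := hasMFDerivAt_unique h1 (hasMFDerivAt_id _)
  have k2 := hasMFDerivAt_unique h2 (hasMFDerivAt_id _)
  exact ContinuousLinearMap.IsInvertible.of_inverse
    (g := (show V × ℂ →L[ℂ] V × ℂ from dscale V ((a⁻¹ : ℂˣ) : ℂ) x ((a : ℂ) • l))) k2 k1

lemma mpullback_scale_toField (s : AtiyahSection V L) (a : ℂˣ) :
    VectorField.mpullback (𝓘(ℂ, V).prod 𝓘(ℂ, ℂ)) (𝓘(ℂ, V).prod 𝓘(ℂ, ℂ)) (scale (L := L) (a : ℂ))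
      (toField s) = toField s := by
  funext p
  have h := (isInvertible_dscale (V := V) a p.1 p.2).inverse_apply_self (toField s p)
  rw [toField_scale] at h
  exact h

/-- The Lie bracket of the invariant vector fields given by two differentiable sections of `E` is
invariant. -/
lemma dscale_mlieBracket [CompleteSpace V] (s t : AtiyahSection V L) (x : M)
    (hs : s.DiffAt x) (ht : t.DiffAt x) :
    (fun l : {l : L x // l ≠ 0} ↦ (VectorField.mlieBracket (𝓘(ℂ, V).prod 𝓘(ℂ, ℂ))
      (toField s) (toField t) (TotalSpace.mk x (l : L x)) : TotTangent V x (l : L x)))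
      ∈ AtiyahFiber V L x := by
  intro a l
  have hne : (a : ℂ) • (l : L x) ≠ 0 := smul_ne_zero a.ne_zero l.2
  have h := VectorField.mpullback_mlieBracket (n := ω) (x₀ := (TotalSpace.mk x (l : L x)))
    (f := scale (L := L) (a : ℂ)) (hs _ hne) (ht _ hne) (contMDiff_scale (a : ℂ) _) (by simp)
  rw [mpullback_scale_toField, mpullback_scale_toField] at h
  have h2 := (isInvertible_dscale (V := V) a x (l : L x)).self_apply_inverse
    (show TotTangent V x ((a : ℂ) • (l : L x)) from
      VectorField.mlieBracket (𝓘(ℂ, V).prod 𝓘(ℂ, ℂ)) (toField s) (toField t)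
      (TotalSpace.mk x ((a : ℂ) • (l : L x))))
  exact (congrArg (dscale V (a : ℂ) x (l : L x)) h.symm).trans h2

/-- The section of `E` given by the infinitesimal generator of the action of `ℂ \ {0}` on `L`. -/
def generator (x : M) : AtiyahFiber V L x :=
  ⟨fun l ↦ generatorAt V x (l : L x), fun a l ↦ dscale_generatorAt (a : ℂ) x (l : L x)⟩

/-- The horizontal lift `TM → E` determined by the connection `D` on `L`. -/
def horizontal (D : CovariantDerivative 𝓘(ℂ, V) ℂ L) (x : M) :
    TangentSpace 𝓘(ℂ, V) x →ₗ[ℂ] AtiyahFiber V L x where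
  toFun X := ⟨fun l ↦ horizontalLiftAt D x (l : L x) X,
    fun a l ↦ dscale_horizontalLiftAt D (a : ℂ) x (l : L x) X⟩
  map_add' X Y := Subtype.ext (funext fun l ↦ map_add (horizontalLiftAt D x (l : L x)) X Y)
  map_smul' c X := Subtype.ext (funext fun l ↦ map_smul (horizontalLiftAt D x (l : L x)) c X)

/-- The section `𝟏` of `E`: the nowhere zero function `u` on `M` is such that `u 𝟏` is the
infinitesimal generator. Together with the horizontal lift it gives the isomorphism
`TM ⊕ ℂ = E`, `(X, c) ↦ X + c 𝟏`. -/
def unitSection (u : M → ℂ) : AtiyahSection V L := fun x ↦ (u x)⁻¹ • generator x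

lemma anchor_horizontal (D : CovariantDerivative 𝓘(ℂ, V) ℂ L) (x : M)
    (X : TangentSpace 𝓘(ℂ, V) x) : anchor x (horizontal D x X) = X :=
  dproj_horizontalLiftAt D x _ X

/-- A section of `TM` is differentiable at `x`. -/
def VectorFieldDiffAt (X : ∀ x : M, TangentSpace 𝓘(ℂ, V) x) (x : M) : Prop :=
  MDifferentiableAt 𝓘(ℂ, V) 𝓘(ℂ, V).tangent (fun y ↦ (⟨y, X y⟩ : TangentBundle 𝓘(ℂ, V) M)) x

variable (V L) in
/-- A `ρ`-connection on the vector bundle `W` over `M`, where `ρ = anchor : E → TM`: to a section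
`σ` of `W` and `e ∈ E_x` it associates `∇_e σ ∈ W_x`, linearly in `e`, additively in `σ`, and
satisfying the Leibniz rule `∇_e (f σ) = f ∇_e σ + ρ(e)(f) σ`. Here, `DiffAt σ x` means that `σ` is
differentiable at `x`. (Sections are arbitrary maps, the conditions being imposed where they
are differentiable; in particular, local sections may be extended arbitrarily outside their domain,
as the axioms imply that `∇_e σ` depends only on the germ of `σ`.) -/
structure RhoConnection (W : M → Type*) [∀ x, AddCommGroup (W x)] [∀ x, Module ℂ (W x)]
    (DiffAt : (∀ x, W x) → M → Prop) where
  /-- `toFun σ x e` is `∇_e σ`. -/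
  toFun : (∀ x, W x) → ∀ x, AtiyahFiber V L x →ₗ[ℂ] W x
  add : ∀ (σ τ : ∀ x, W x) (x : M), DiffAt σ x → DiffAt τ x →
    ∀ e, toFun (σ + τ) x e = toFun σ x e + toFun τ x e
  leibniz : ∀ (f : M → ℂ) (σ : ∀ x, W x) (x : M), MDifferentiableAt 𝓘(ℂ, V) 𝓘(ℂ, ℂ) f x →
    DiffAt σ x → ∀ e, toFun (fun y ↦ f y • σ y) x e =
      f x • toFun σ x e + mvfderiv 𝓘(ℂ, V) f x (anchor x e) • σ x

variable (V L) in
/-- The `ρ`-connections on `TM`. -/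
abbrev RhoConnectionTM : Type _ :=
  RhoConnection V L (fun x : M ↦ TangentSpace 𝓘(ℂ, V) x) VectorFieldDiffAt

variable (V L) in
/-- The `ρ`-connections on `E`. -/
abbrev RhoConnectionE : Type _ :=
  RhoConnection V L (fun x : M ↦ AtiyahFiber V L x) AtiyahSection.DiffAt

/-- The torsion of a `ρ`-connection on `E`, evaluated on sections of `E`. -/
def rhoTorsion (nab : RhoConnectionE V L) (s t : AtiyahSection V L) (x : M) : AtiyahFiber V L x :=
  nab.toFun t x (s x) - nab.toFun s x (t x) - atiyahBracket s t x

/-- The connection on `TM` given by a `ρ`-connection on `TM` and the connection `D` on `L`: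
`∇_X Y` is `∇_e Y`, where `e ∈ E` is the horizontal lift of `X`. -/
def inducedConnection [FiniteDimensional ℂ V] (D : CovariantDerivative 𝓘(ℂ, V) ℂ L)
    (nab : RhoConnectionTM V L) :
    CovariantDerivative 𝓘(ℂ, V) V (fun x : M ↦ TangentSpace 𝓘(ℂ, V) x) where
  toFun Y x := (LinearMap.toContinuousLinearMap (nab.toFun Y x ∘ₗ horizontal D x : V →ₗ[ℂ] V) : V →L[ℂ] V)
  isCovariantDerivativeOnUniv :=
    { add := by
        intro σ τ x hσ hτ _
        ext X
        exact nab.add σ τ x hσ hτ (horizontal D x X)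
      leibniz := by
        intro σ f x hσ hf _
        ext X'
        let X : TangentSpace 𝓘(ℂ, V) x := X'
        have h := nab.leibniz f σ x hf hσ (horizontal D x X)
        rw [anchor_horizontal] at h
        exact h }

/-- The connection `D` on `L` is holomorphic: over each open set, it maps holomorphic sections of
`L` to holomorphic sections of `Hom(TM, L)`. -/
def IsHolomorphicConnection (D : CovariantDerivative 𝓘(ℂ, V) ℂ L) : Prop :=
  ∀ U : Set M, IsOpen U → ContMDiffCovariantDerivativeOn ℂ ω D.toFun U

/-- `D_X D_Y σ - D_Y D_X σ - D_[X, Y] σ`. -/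
def curvatureOperator (D : CovariantDerivative 𝓘(ℂ, V) ℂ L)
    (X Y : ∀ x : M, TangentSpace 𝓘(ℂ, V) x) (σ : ∀ x, L x) (x : M) : L x :=
  D (fun y ↦ D σ y (Y y)) x (X x) - D (fun y ↦ D σ y (X y)) x (Y x)
    - D σ x (VectorField.mlieBracket 𝓘(ℂ, V) X Y x)

/-- The curvature form `Ω` of the connection `D` on the line bundle `L`, characterised by
`Ω(X, Y) σ = D_X D_Y σ - D_Y D_X σ - D_[X, Y] σ`. It is computed by extending `X` and `Y` to
holomorphic vector fields around `x`, and by taking `σ` to be a holomorphic section of `L` around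
`x` whose value at `x` has coordinate `1`. -/
def curvatureForm (D : CovariantDerivative 𝓘(ℂ, V) ℂ L) (x : M)
    (X Y : TangentSpace 𝓘(ℂ, V) x) : ℂ :=
  fiberCoord x (curvatureOperator D (FiberBundle.extend V X) (FiberBundle.extend V Y)
    (localSection x ((fiberCoord x).symm 1)) x)

variable (V M) in
/-- A holomorphic Riemannian metric on `M`. -/
structure HolomorphicMetric where
  /-- The bilinear form on each tangent space. -/
  inner (x : M) : TangentSpace 𝓘(ℂ, V) x →L[ℂ] TangentSpace 𝓘(ℂ, V) x →L[ℂ] ℂ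
  symm (x : M) (X Y : TangentSpace 𝓘(ℂ, V) x) : inner x X Y = inner x Y X
  nondegenerate (x : M) (X : TangentSpace 𝓘(ℂ, V) x) : (∀ Y, inner x X Y = 0) → X = 0
  contMDiff : ContMDiff 𝓘(ℂ, V) (𝓘(ℂ, V).prod 𝓘(ℂ, V →L[ℂ] V →L[ℂ] ℂ)) ω
    (fun x ↦ TotalSpace.mk' (V →L[ℂ] V →L[ℂ] ℂ) x (inner x))

/-- The relations between the `ρ`-connection `nabE` on `E`, the `ρ`-connection `nab` on `TM`, and the
section `γ` of `Hom(E, TM)`, through the section `h` of `Hom(TM, End(TM))` and the metric `g`.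
Vector fields on `M` are seen as sections of `E` through the horizontal lift. -/
structure IsTildeConnection (D : CovariantDerivative 𝓘(ℂ, V) ℂ L) (u : M → ℂ)
    (g : HolomorphicMetric V M)
    (h : ∀ x : M, TangentSpace 𝓘(ℂ, V) x →ₗ[ℂ]
      TangentSpace 𝓘(ℂ, V) x →ₗ[ℂ] TangentSpace 𝓘(ℂ, V) x)
    (γ : ∀ x : M, AtiyahFiber V L x →ₗ[ℂ] TangentSpace 𝓘(ℂ, V) x)
    (nab : RhoConnectionTM V L) (nabE : RhoConnectionE V L) : Prop where
  horizontal_horizontal : ∀ (x : M) (X : TangentSpace 𝓘(ℂ, V) x)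
    (Y : ∀ y : M, TangentSpace 𝓘(ℂ, V) y), VectorFieldDiffAt Y x →
    nabE.toFun (fun y ↦ horizontal D y (Y y)) x (horizontal D x X) =
      horizontal D x (nab.toFun Y x (horizontal D x X) + h x (γ x (horizontal D x X)) (Y x))
        - g.inner x (γ x (horizontal D x X)) (Y x) • unitSection u x
  horizontal_unit : ∀ (x : M) (X : TangentSpace 𝓘(ℂ, V) x),
    nabE.toFun (unitSection u) x (horizontal D x X) =
      horizontal D x (γ x (horizontal D x X))
  unit_horizontal : ∀ (x : M) (X : ∀ y : M, TangentSpace 𝓘(ℂ, V) y), VectorFieldDiffAt X x →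
    nabE.toFun (fun y ↦ horizontal D y (X y)) x (unitSection u x) =
      horizontal D x (nab.toFun X x (unitSection u x) + h x (γ x (unitSection u x)) (X x))
        - g.inner x (γ x (unitSection u x)) (X x) • unitSection u x
  unit_unit : ∀ x : M,
    nabE.toFun (unitSection u) x (unitSection u x) = horizontal D x (γ x (unitSection u x))

end Setting
end LineBundleAtiyah
end

open LineBundleAtiyah

/-!
In a local trivialization of `L` with fibre coordinate `l`, an invariant vector field on `L \ 0` is
`X + c G`, where `G = l ∂/∂l` generates the action and the vector field `X` and the function `c`
live on the base, so that `[X + c G, Y + d G] = [X, Y] + (X(d) - Y(c)) G`. The horizontal lift of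
`X` is `X - θ(X) G`, where `θ` is the connection form. As the curvature is `Ω = dθ`, the horizontal
lifts satisfy `[X, Y]_E = [X, Y] - Ω(X, Y) G` and `[X, u⁻¹ G]_E = X(u⁻¹) G = - u⁻² X(u) G`.
Substituting these in the torsion, with `G = u 𝟏`, gives both formulas.
-/

noncomputable section

namespace LineBundleAtiyah

open VectorField

section Chart

variable {𝕜 : Type*} [NontriviallyNormedField 𝕜]
  {V : Type*} [NormedAddCommGroup V] [NormedSpace 𝕜 V]
  {H : Type*} [TopologicalSpace H] {I : ModelWithCorners 𝕜 V H}
  {M : Type*} [TopologicalSpace M] [ChartedSpace H M]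
  {F : Type*} [NormedAddCommGroup F] [NormedSpace 𝕜 F]
  {G : Type*} [NormedAddCommGroup G] [NormedSpace 𝕜 G]

lemma mvfderiv_prodMk {f : M → F} {g : M → G} {p : M}
    (hf : MDifferentiableAt I 𝓘(𝕜, F) f p) (hg : MDifferentiableAt I 𝓘(𝕜, G) g p)
    (v : TangentSpace I p) :
    mvfderiv I (fun q ↦ (f q, g q)) p v = (mvfderiv I f p v, mvfderiv I g p v) := by
  have h : HasMFDerivAt I 𝓘(𝕜, F × G) (fun q ↦ (f q, g q)) p
      ((mvfderiv I f p).prod (mvfderiv I g p)) :=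
    ⟨hf.continuousAt.prodMk hg.continuousAt, hf.hasMFDerivAt.2.prodMk hg.hasMFDerivAt.2⟩
  exact congrArg (fun A : V →L[𝕜] F × G ↦ A v) h.mfderiv

lemma mvfderiv_congr {f g : M → F} {p : M} (h : f =ᶠ[𝓝 p] g) :
    mvfderiv I f p = mvfderiv I g p :=
  ContinuousLinearMap.ext fun v ↦ congrArg (fun A : V →L[𝕜] F ↦ A v) h.mfderiv_eq

lemma mvfderiv_vector_comp_apply_of_eq {V' : Type*} [NormedAddCommGroup V'] [NormedSpace 𝕜 V']
    {H' : Type*} [TopologicalSpace H'] {J : ModelWithCorners 𝕜 V' H'}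
    {N : Type*} [TopologicalSpace N] [ChartedSpace H' N] {g : M → F} {f : N → M} {n : N} {p : M}
    (hg : MDifferentiableAt I 𝓘(𝕜, F) g p) (hf : MDifferentiableAt J I f n) (hn : f n = p)
    (w : TangentSpace J n) :
    mvfderiv J (fun m ↦ g (f m)) n w = mvfderiv I g p (mfderiv J I f n w) :=
  mfderiv_comp_apply_of_eq n hg hf hn w

lemma mvfderiv_clm_apply {A : M → F →L[𝕜] G} {f : M → F} {p : M}
    (hA : MDifferentiableAt I 𝓘(𝕜, F →L[𝕜] G) A p) (hf : MDifferentiableAt I 𝓘(𝕜, F) f p)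
    (v : TangentSpace I p) :
    mvfderiv I (fun q ↦ A q (f q)) p v = mvfderiv I A p v (f p) + A p (mvfderiv I f p v) := by
  have happly := (isBoundedBilinearMap_apply (𝕜 := 𝕜) (E := F) (F := G)).hasFDerivAt (A p, f p)
  refine (mvfderiv_vector_comp_apply_of_eq happly.hasMFDerivAt.mdifferentiableAt
    (hA.prodMk_space hf) rfl v).trans ?_
  refine (congrArg (fun B : (F →L[𝕜] G) × F →L[𝕜] G ↦ B _) happly.hasMFDerivAt.mfderiv).trans ?_
  exact (congrArg (isBoundedBilinearMap_apply.deriv (A p, f p)) (mvfderiv_prodMk hA hf v)).trans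
    (add_comm _ _)

lemma mdifferentiableAt_inv {f : M → 𝕜} {p : M} (hf : MDifferentiableAt I 𝓘(𝕜, 𝕜) f p)
    (hp : f p ≠ 0) : MDifferentiableAt I 𝓘(𝕜, 𝕜) (fun q ↦ (f q)⁻¹) p :=
  (differentiableAt_inv hp).mdifferentiableAt.comp p hf

lemma mvfderiv_inv {f : M → 𝕜} {p : M} (hf : MDifferentiableAt I 𝓘(𝕜, 𝕜) f p) (hp : f p ≠ 0)
    (v : TangentSpace I p) :
    mvfderiv I (fun q ↦ (f q)⁻¹) p v = -((f p)⁻¹ * mvfderiv I f p v) * (f p)⁻¹ := by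
  have hcomp := mvfderiv_comp_apply p (differentiableAt_inv hp).mdifferentiableAt hf v
  have hinv : mvfderiv 𝓘(𝕜, 𝕜) (fun z : 𝕜 ↦ z⁻¹) (f p) (mfderiv I 𝓘(𝕜, 𝕜) f p v) =
      mvfderiv I f p v * -(f p ^ 2)⁻¹ :=
    congrArg (fun A : 𝕜 →L[𝕜] 𝕜 ↦ A (mvfderiv I f p v))
      (hasDerivAt_inv hp).hasFDerivAt.hasMFDerivAt.mfderiv
  refine hcomp.trans (hinv.trans ?_)
  field_simp

variable (I) in
/-- The coordinate expression, in the preferred chart at `p`, of a vector field `X`. -/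
def chartRep (p : M) (X : ∀ q : M, TangentSpace I q) (q : M) : V :=
  mvfderiv I (extChartAt I p) q (X q)

variable [IsManifold I 1 M]

lemma mvfderiv_extChartAt_self (p : M) (v : TangentSpace I p) :
    mvfderiv I (extChartAt I p) p v = v :=
  congrArg (fun A : V →L[𝕜] V ↦ A v) (mfderiv_extChartAt_self (I := I) (x := p))

lemma trivializationAt_tangent_snd {p q : M} (hq : q ∈ (chartAt H p).source)
    (v : TangentSpace I q) :
    (trivializationAt V (TangentSpace I : M → Type _) p (⟨q, v⟩ : TangentBundle I M)).2 =
      mvfderiv I (extChartAt I p) q v := by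
  have hq' : q ∈ (trivializationAt V (TangentSpace I : M → Type _) p).baseSet := by simpa using hq
  rw [← Trivialization.continuousLinearMapAt_apply_of_mem (R := 𝕜) _ hq',
    TangentBundle.continuousLinearMapAt_trivializationAt (I := I) hq]
  rfl

lemma mdifferentiableAt_iff_chartRep (X : ∀ q : M, TangentSpace I q) (p : M) :
    MDifferentiableAt I I.tangent (fun q ↦ (⟨q, X q⟩ : TangentBundle I M)) p ↔
      MDifferentiableAt I 𝓘(𝕜, V) (chartRep I p X) p := by
  refine (mdifferentiableAt_section I X).trans (Filter.EventuallyEq.mdifferentiableAt_iff ?_)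
  filter_upwards [chart_source_mem_nhds H p] with q hq
  exact trivializationAt_tangent_snd hq (X q)

lemma mpullbackWithin_extChartAt_symm (p : M) (X : ∀ q : M, TangentSpace I q) {z : V}
    (hz : z ∈ (extChartAt I p).target) :
    mpullbackWithin 𝓘(𝕜, V) I (extChartAt I p).symm X (range I) z =
      chartRep I p X ((extChartAt I p).symm z) := by
  have h := mfderivWithin_extChartAt_symm_comp_mfderiv_extChartAt (I := I) hz
  exact (isInvertible_mfderivWithin_extChartAt_symm hz).inverse_apply_eq.2
    (congrArg (fun A : V →L[𝕜] V ↦ A (X ((extChartAt I p).symm z))) h).symm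

lemma mpullbackWithin_extChartAt_symm_self (p : M) (X : ∀ q : M, TangentSpace I q) :
    mpullbackWithin 𝓘(𝕜, V) I (extChartAt I p).symm X (range I) (extChartAt I p p) = X p := by
  refine (mpullbackWithin_extChartAt_symm p X (mem_extChartAt_target p)).trans ?_
  rw [extChartAt_to_inv]
  exact mvfderiv_extChartAt_self p (X p)

lemma fderivWithin_mpullbackWithin_extChartAt_symm {p : M} {X : ∀ q : M, TangentSpace I q}
    (hX : MDifferentiableAt I 𝓘(𝕜, V) (chartRep I p X) p) :
    (fderivWithin 𝕜 (mpullbackWithin 𝓘(𝕜, V) I (extChartAt I p).symm X (range I) : V → V)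
      (range I) (extChartAt I p p) : V →L[𝕜] V) = mvfderiv I (chartRep I p X) p := by
  refine Eq.trans (Filter.EventuallyEq.fderivWithin_eq_of_mem ?_ (mem_range_self _))
    hX.mvfderiv.symm
  filter_upwards [extChartAt_target_mem_nhdsWithin (I := I) p] with z hz
  exact mpullbackWithin_extChartAt_symm p X hz

lemma mlieBracket_eq_lieBracketWithin_mpullbackWithin (p : M) (X Y : ∀ q : M, TangentSpace I q) :
    mlieBracket I X Y p =
      lieBracketWithin 𝕜 (mpullbackWithin 𝓘(𝕜, V) I (extChartAt I p).symm X (range I))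
        (mpullbackWithin 𝓘(𝕜, V) I (extChartAt I p).symm Y (range I)) (range I)
        (extChartAt I p p) := by
  refine (mlieBracketWithin_apply (s := univ)).trans ?_
  rw [preimage_univ, univ_inter]
  exact (isInvertible_mfderiv_extChartAt (mem_extChartAt_source p)).inverse_apply_eq.2
    (mvfderiv_extChartAt_self (I := I) p (_ : V)).symm

lemma mlieBracket_eq_chartRep {p : M} {X Y : ∀ q : M, TangentSpace I q}
    (hX : MDifferentiableAt I 𝓘(𝕜, V) (chartRep I p X) p)
    (hY : MDifferentiableAt I 𝓘(𝕜, V) (chartRep I p Y) p) :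
    mlieBracket I X Y p =
      mvfderiv I (chartRep I p Y) p (X p) - mvfderiv I (chartRep I p X) p (Y p) := by
  have hderiv {Z : ∀ q : M, TangentSpace I q} (W : ∀ q : M, TangentSpace I q)
      (hZ : MDifferentiableAt I 𝓘(𝕜, V) (chartRep I p Z) p) :=
    congr_arg₂ (fun (A : V →L[𝕜] V) (v : V) ↦ A v)
      (fderivWithin_mpullbackWithin_extChartAt_symm hZ) (mpullbackWithin_extChartAt_symm_self p W)
  exact (mlieBracket_eq_lieBracketWithin_mpullbackWithin p X Y).trans
    (congr_arg₂ (fun v w : V ↦ v - w) (hderiv X hY) (hderiv Y hX))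

end Chart

section FiberVar

variable {𝕜 : Type*} [NontriviallyNormedField 𝕜]
  {B : Type*} [TopologicalSpace B]
  {F : Type*} [NormedAddCommGroup F] [NormedSpace 𝕜 F]
  {E : B → Type*} [TopologicalSpace (TotalSpace F E)] [∀ x, TopologicalSpace (E x)]
  [FiberBundle F E]

/-- The fibre coordinate on the total space of `E` given by the preferred trivialization at `x`. -/
def fiberVar (x : B) (q : TotalSpace F E) : F := (trivializationAt F E x q).2

lemma eventually_mem_baseSet (x : B) : ∀ᶠ y in 𝓝 x, y ∈ (trivializationAt F E x).baseSet :=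
  (trivializationAt F E x).open_baseSet.mem_nhds (FiberBundle.mem_baseSet_trivializationAt' x)

variable [∀ x, AddCommGroup (E x)] [∀ x, Module 𝕜 (E x)] [VectorBundle 𝕜 F E] {x y : B}

include 𝕜 in
lemma fiberVar_add (hy : y ∈ (trivializationAt F E x).baseSet) (l m : E y) :
    fiberVar x (TotalSpace.mk y (l + m) : TotalSpace F E) =
      fiberVar x (TotalSpace.mk y l) + fiberVar x (TotalSpace.mk y m) :=
  ((trivializationAt F E x).linear 𝕜 hy).map_add l m

lemma fiberVar_smul (hy : y ∈ (trivializationAt F E x).baseSet) (a : 𝕜) (l : E y) :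
    fiberVar x (TotalSpace.mk y (a • l) : TotalSpace F E) = a • fiberVar x (TotalSpace.mk y l) :=
  ((trivializationAt F E x).linear 𝕜 hy).map_smul a l

end FiberVar

section TangentSplit

variable {𝕜 : Type*} [NontriviallyNormedField 𝕜]
  {V : Type*} [NormedAddCommGroup V] [NormedSpace 𝕜 V]
  {H : Type*} [TopologicalSpace H] {I : ModelWithCorners 𝕜 V H}
  {B : Type*} [TopologicalSpace B] [ChartedSpace H B]
  {F : Type*} [NormedAddCommGroup F] [NormedSpace 𝕜 F]
  {E : B → Type*} [TopologicalSpace (TotalSpace F E)] [∀ x, TopologicalSpace (E x)]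
  [FiberBundle F E]

variable (I) in
/-- The differentials at `q` of the bundle projection and of the fibre coordinate given by the
preferred trivialization at `x`: the components of a tangent vector to the total space along the
base and along the fibre. -/
def tangentSplit (x : B) (q : TotalSpace F E) :
    TangentSpace (I.prod 𝓘(𝕜, F)) q →L[𝕜] TangentSpace I q.proj × F :=
  (mfderiv (I.prod 𝓘(𝕜, F)) I (TotalSpace.proj : TotalSpace F E → B) q).prod
    (mvfderiv (I.prod 𝓘(𝕜, F)) (fiberVar x) q)

lemma extChartAt_totalSpace_eventuallyEq (x : B) (l : E x) {q : TotalSpace F E}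
    (hq : q.proj ∈ (trivializationAt F E x).baseSet) :
    extChartAt (I.prod 𝓘(𝕜, F)) (TotalSpace.mk x l : TotalSpace F E) =ᶠ[𝓝 q]
      fun q ↦ (extChartAt I x q.proj, fiberVar x q) := by
  have hbase := ((trivializationAt F E x).open_baseSet.preimage
    (FiberBundle.continuous_proj F E)).mem_nhds hq
  filter_upwards [hbase] with q hq
  rw [FiberBundle.extChartAt]
  simp only [PartialEquiv.trans_apply, PartialEquiv.prod_coe, PartialEquiv.refl_coe,
    OpenPartialHomeomorph.coe_toPartialEquiv, Trivialization.coe_coe, id_eq]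
  rw [Trivialization.coe_fst' _ hq]
  rfl

lemma mdifferentiableAt_proj (q : TotalSpace F E) :
    MDifferentiableAt (I.prod 𝓘(𝕜, F)) I (TotalSpace.proj : TotalSpace F E → B) q :=
  (Bundle.contMDiff_proj (n := 1) E q).mdifferentiableAt one_ne_zero

lemma mdifferentiableAt_comp_proj {G : Type*} [NormedAddCommGroup G] [NormedSpace 𝕜 G]
    {f : B → G} {x : B} (hf : MDifferentiableAt I 𝓘(𝕜, G) f x) (l : E x) :
    MDifferentiableAt (I.prod 𝓘(𝕜, F)) 𝓘(𝕜, G) (fun q : TotalSpace F E ↦ f q.proj)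
      (TotalSpace.mk x l) :=
  MDifferentiableAt.comp (TotalSpace.mk x l) hf (mdifferentiableAt_proj (TotalSpace.mk x l))

variable [∀ x, AddCommGroup (E x)] [∀ x, Module 𝕜 (E x)] [VectorBundle 𝕜 F E]
  [ContMDiffVectorBundle 1 F E I]

lemma mdifferentiableAt_fiberVar {x : B} {q : TotalSpace F E}
    (hq : q.proj ∈ (trivializationAt F E x).baseSet) :
    MDifferentiableAt (I.prod 𝓘(𝕜, F)) 𝓘(𝕜, F) (fiberVar (E := E) x) q :=
  (((trivializationAt F E x).mdifferentiableAt_totalSpace_iff (IB := I) (fun q ↦ q)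
    ((trivializationAt F E x).mem_source.2 hq)).1 mdifferentiableAt_id).2

lemma tangentSplit_mfderiv {V' : Type*} [NormedAddCommGroup V'] [NormedSpace 𝕜 V']
    {H' : Type*} [TopologicalSpace H'] {J : ModelWithCorners 𝕜 V' H'}
    {N : Type*} [TopologicalSpace N] [ChartedSpace H' N] {f : N → TotalSpace F E} {n : N}
    {x : B} {q : TotalSpace F E} (hq : q.proj ∈ (trivializationAt F E x).baseSet)
    (hf : MDifferentiableAt J (I.prod 𝓘(𝕜, F)) f n) (hn : f n = q) (w : TangentSpace J n) :
    tangentSplit I x q (mfderiv J (I.prod 𝓘(𝕜, F)) f n w) =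
      (mfderiv J I (fun m ↦ (f m).proj) n w, mvfderiv J (fun m ↦ fiberVar x (f m)) n w) :=
  Prod.ext (mfderiv_comp_apply_of_eq n (mdifferentiableAt_proj q) hf hn w).symm
    (mvfderiv_vector_comp_apply_of_eq (mdifferentiableAt_fiberVar hq) hf hn w).symm

lemma tangentSplit_mfderiv_fiberCurve {x y : B} (hy : y ∈ (trivializationAt F E x).baseSet)
    {c : 𝕜 → E y} {z : 𝕜} {l : E y} {d : F}
    (hc : HasDerivAt (fun t ↦ fiberVar x (TotalSpace.mk y (c t) : TotalSpace F E)) d z)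
    (hz : c z = l) (w : 𝕜) :
    tangentSplit I x (TotalSpace.mk y l)
      (mfderiv 𝓘(𝕜, 𝕜) (I.prod 𝓘(𝕜, F)) (fun t ↦ (TotalSpace.mk y (c t) : TotalSpace F E)) z w) =
      (0, w • d) := by
  have hcurve : MDifferentiableAt 𝓘(𝕜, 𝕜) (I.prod 𝓘(𝕜, F))
      (fun t ↦ (TotalSpace.mk y (c t) : TotalSpace F E)) z :=
    ((trivializationAt F E x).mdifferentiableAt_totalSpace_iff (IB := I) _
      ((trivializationAt F E x).mem_source.2 hy)).2
      ⟨mdifferentiableAt_const, hc.differentiableAt.mdifferentiableAt⟩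
  refine (tangentSplit_mfderiv hy hcurve (congrArg _ hz) w).trans (Prod.ext ?_ ?_)
  · exact congrArg (fun A : 𝕜 →L[𝕜] V ↦ A w) (hasMFDerivAt_const (I := 𝓘(𝕜, 𝕜)) y z).mfderiv
  · exact congrArg (fun A : 𝕜 →L[𝕜] F ↦ A w) hc.hasFDerivAt.hasMFDerivAt.mfderiv

variable {c : B → 𝕜} {x : B}

lemma mdifferentiableAt_smul_fiberVar (hc : MDifferentiableAt I 𝓘(𝕜, 𝕜) c x) (l : E x) :
    MDifferentiableAt (I.prod 𝓘(𝕜, F)) 𝓘(𝕜, F)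
      (fun q : TotalSpace F E ↦ c q.proj • fiberVar x q) (TotalSpace.mk x l) :=
  (mdifferentiableAt_comp_proj hc l).smul
    (mdifferentiableAt_fiberVar (FiberBundle.mem_baseSet_trivializationAt' x))

lemma mvfderiv_smul_fiberVar (hc : MDifferentiableAt I 𝓘(𝕜, 𝕜) c x) (l : E x)
    (w : TangentSpace (I.prod 𝓘(𝕜, F)) (TotalSpace.mk' F x l)) :
    mvfderiv (I.prod 𝓘(𝕜, F)) (fun q : TotalSpace F E ↦ c q.proj • fiberVar x q)
      (TotalSpace.mk x l) w =
      c x • (tangentSplit I x (TotalSpace.mk x l) w).2 +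
        mvfderiv I c x (tangentSplit I x (TotalSpace.mk x l) w).1 •
          fiberVar x (TotalSpace.mk' F x l) := by
  have hmul := mvfderiv_smul (mdifferentiableAt_comp_proj hc l)
    (mdifferentiableAt_fiberVar (I := I) (q := TotalSpace.mk' F x l)
      (FiberBundle.mem_baseSet_trivializationAt' x))
  refine (congrArg (fun A : V × F →L[𝕜] F ↦ A w) hmul).trans ?_
  exact congrArg (fun z : 𝕜 ↦ (_ + z • fiberVar x (TotalSpace.mk' F x l) : F))
    (mvfderiv_vector_comp_apply_of_eq hc (mdifferentiableAt_proj _) rfl w)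

variable [IsManifold I 1 B]

lemma mvfderiv_extChartAt_totalSpace (x : B) (l : E x) {q : TotalSpace F E}
    (hq : q.proj ∈ (trivializationAt F E x).baseSet) (hq' : q.proj ∈ (chartAt H x).source)
    (w : TangentSpace (I.prod 𝓘(𝕜, F)) q) :
    mvfderiv (I.prod 𝓘(𝕜, F))
      (extChartAt (I.prod 𝓘(𝕜, F)) (TotalSpace.mk x l : TotalSpace F E)) q w =
      (mvfderiv I (extChartAt I x) q.proj (tangentSplit I x q w).1, (tangentSplit I x q w).2) := by
  have hchart := mdifferentiableAt_extChartAt (I := I) hq'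
  rw [mvfderiv_congr (extChartAt_totalSpace_eventuallyEq x l hq)]
  refine (mvfderiv_prodMk (hchart.comp q (mdifferentiableAt_proj q))
    (mdifferentiableAt_fiberVar hq) w).trans (Prod.ext ?_ rfl)
  exact mvfderiv_vector_comp_apply_of_eq hchart (mdifferentiableAt_proj q) rfl w

lemma tangentSplit_self (x : B) (l : E x)
    (w : TangentSpace (I.prod 𝓘(𝕜, F)) (TotalSpace.mk x l : TotalSpace F E)) :
    tangentSplit I x (TotalSpace.mk x l) w = w := by
  have hsplit := mvfderiv_extChartAt_totalSpace x l (q := TotalSpace.mk x l)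
    (FiberBundle.mem_baseSet_trivializationAt' x) (mem_chart_source H x) w
  have hfst := mvfderiv_extChartAt_self (I := I) x (tangentSplit I x (TotalSpace.mk x l) w).1
  exact (Prod.ext hfst.symm rfl : _ = (_, _)).trans (hsplit.symm.trans
    (mvfderiv_extChartAt_self (I := I.prod 𝓘(𝕜, F)) (TotalSpace.mk x l) w))

variable {l : E x} {X Y : ∀ y : B, TangentSpace I y} {a b : TotalSpace F E → F}
  {Z W : ∀ q : TotalSpace F E, TangentSpace (I.prod 𝓘(𝕜, F)) q}

lemma chartRep_totalSpace_eventuallyEq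
    (hZ : ∀ᶠ q in 𝓝 (TotalSpace.mk x l : TotalSpace F E),
      tangentSplit I x q (Z q) = (X q.proj, a q)) :
    chartRep (I.prod 𝓘(𝕜, F)) (TotalSpace.mk x l : TotalSpace F E) Z
      =ᶠ[𝓝 (TotalSpace.mk x l)] fun q ↦ (chartRep I x X q.proj, a q) := by
  have hproj : Filter.Tendsto (TotalSpace.proj : TotalSpace F E → B) (𝓝 (TotalSpace.mk x l))
      (𝓝 x) := (FiberBundle.continuous_proj F E).tendsto _
  filter_upwards [hZ, hproj.eventually (eventually_mem_baseSet (F := F) (E := E) x),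
    hproj.eventually (chart_source_mem_nhds H x)] with q hq hqx hqc
  refine (mvfderiv_extChartAt_totalSpace x l hqx hqc (Z q)).trans ?_
  rw [hq]
  rfl

lemma mdifferentiableAt_of_tangentSplit
    (hZ : ∀ᶠ q in 𝓝 (TotalSpace.mk x l : TotalSpace F E),
      tangentSplit I x q (Z q) = (X q.proj, a q))
    (hX : MDifferentiableAt I 𝓘(𝕜, V) (chartRep I x X) x)
    (ha : MDifferentiableAt (I.prod 𝓘(𝕜, F)) 𝓘(𝕜, F) a (TotalSpace.mk x l)) :
    MDifferentiableAt (I.prod 𝓘(𝕜, F)) 𝓘(𝕜, V × F)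
      (chartRep (I.prod 𝓘(𝕜, F)) (TotalSpace.mk x l) Z) (TotalSpace.mk x l) :=
  ((mdifferentiableAt_comp_proj hX l).prodMk_space ha).congr_of_eventuallyEq
    (chartRep_totalSpace_eventuallyEq hZ)

lemma mvfderiv_chartRep_totalSpace
    (hZ : ∀ᶠ q in 𝓝 (TotalSpace.mk x l : TotalSpace F E),
      tangentSplit I x q (Z q) = (X q.proj, a q))
    (hX : MDifferentiableAt I 𝓘(𝕜, V) (chartRep I x X) x)
    (ha : MDifferentiableAt (I.prod 𝓘(𝕜, F)) 𝓘(𝕜, F) a (TotalSpace.mk x l))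
    (w : TangentSpace (I.prod 𝓘(𝕜, F)) (TotalSpace.mk x l : TotalSpace F E)) :
    mvfderiv (I.prod 𝓘(𝕜, F)) (chartRep (I.prod 𝓘(𝕜, F)) (TotalSpace.mk x l) Z)
      (TotalSpace.mk x l) w =
        (mvfderiv I (chartRep I x X) x (tangentSplit I x (TotalSpace.mk x l) w).1,
          mvfderiv (I.prod 𝓘(𝕜, F)) a (TotalSpace.mk x l) w) := by
  rw [mvfderiv_congr (chartRep_totalSpace_eventuallyEq hZ)]
  refine (mvfderiv_prodMk (mdifferentiableAt_comp_proj hX l) ha w).trans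
    (Prod.ext ?_ rfl)
  exact mvfderiv_vector_comp_apply_of_eq hX (mdifferentiableAt_proj _) rfl w

lemma tangentSplit_mlieBracket
    (hZ : ∀ᶠ q in 𝓝 (TotalSpace.mk x l : TotalSpace F E),
      tangentSplit I x q (Z q) = (X q.proj, a q))
    (hW : ∀ᶠ q in 𝓝 (TotalSpace.mk x l : TotalSpace F E),
      tangentSplit I x q (W q) = (Y q.proj, b q))
    (hX : MDifferentiableAt I 𝓘(𝕜, V) (chartRep I x X) x)
    (hY : MDifferentiableAt I 𝓘(𝕜, V) (chartRep I x Y) x)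
    (ha : MDifferentiableAt (I.prod 𝓘(𝕜, F)) 𝓘(𝕜, F) a (TotalSpace.mk x l))
    (hb : MDifferentiableAt (I.prod 𝓘(𝕜, F)) 𝓘(𝕜, F) b (TotalSpace.mk x l)) :
    tangentSplit I x (TotalSpace.mk x l) (mlieBracket (I.prod 𝓘(𝕜, F)) Z W (TotalSpace.mk x l)) =
      (mlieBracket I X Y x,
        mvfderiv (I.prod 𝓘(𝕜, F)) b (TotalSpace.mk x l) (Z (TotalSpace.mk x l)) -
          mvfderiv (I.prod 𝓘(𝕜, F)) a (TotalSpace.mk x l) (W (TotalSpace.mk x l))) := by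
  rw [tangentSplit_self, mlieBracket_eq_chartRep hX hY,
    mlieBracket_eq_chartRep (mdifferentiableAt_of_tangentSplit hZ hX ha)
      (mdifferentiableAt_of_tangentSplit hW hY hb),
    mvfderiv_chartRep_totalSpace hZ hX ha, mvfderiv_chartRep_totalSpace hW hY hb,
    hZ.self_of_nhds, hW.self_of_nhds]
  rfl

end TangentSplit

section LineBundle

variable {V : Type*} [NormedAddCommGroup V] [NormedSpace ℂ V]
  {M : Type*} [TopologicalSpace M] [ChartedSpace V M]
  {L : M → Type*} [TopologicalSpace (TotalSpace ℂ L)]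
  [∀ x, AddCommGroup (L x)] [∀ x, Module ℂ (L x)] [∀ x, TopologicalSpace (L x)]
  [FiberBundle ℂ L] [VectorBundle ℂ ℂ L] {x y : M}

/-- The local frame of `L` whose coordinate in the preferred trivialization at `x` is `1`. -/
def frame (x y : M) : L y := localSection x ((fiberCoord x).symm 1) y

lemma fiberVar_frame (hy : y ∈ (trivializationAt ℂ L x).baseSet) :
    fiberVar x (TotalSpace.mk' ℂ y (frame x y : L y)) = 1 := by
  rw [frame, localSection, ContinuousLinearEquiv.apply_symm_apply, fiberVar,
    Trivialization.symmL_apply _ hy, Trivialization.apply_mk_symm _ hy]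

lemma fiberVar_smul_frame (hy : y ∈ (trivializationAt ℂ L x).baseSet) (l : L y) :
    fiberVar x (TotalSpace.mk' ℂ y l) • frame x y = l := by
  have hsymm := (trivializationAt ℂ L x).symm_apply_apply_mk hy l
  rwa [← Trivialization.symmL_apply (R := ℂ) _ hy, ← mul_one (trivializationAt ℂ L x _).2,
    ← smul_eq_mul, map_smul, ← (fiberCoord (L := L) x).apply_symm_apply 1] at hsymm

lemma fiberVar_ne_zero (hy : y ∈ (trivializationAt ℂ L x).baseSet) {l : L y} (hl : l ≠ 0) :
    fiberVar x (TotalSpace.mk' ℂ y l) ≠ 0 := fun h ↦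
  hl (by rw [← fiberVar_smul_frame hy l, h, zero_smul])

lemma snd_ne_zero_of_fiberVar {q : TotalSpace ℂ L} (hq : q.proj ∈ (trivializationAt ℂ L x).baseSet)
    (h : fiberVar x q ≠ 0) : q.2 ≠ 0 := by
  intro h0
  have hsmul := fiberVar_smul hq (0 : ℂ) q.2
  rw [zero_smul, zero_smul, ← h0] at hsmul
  exact h hsmul

lemma contMDiffOn_frame (n : ℕ∞ω) [ContMDiffVectorBundle n ℂ L 𝓘(ℂ, V)] (x : M) :
    ContMDiffOn 𝓘(ℂ, V) (𝓘(ℂ, V).prod 𝓘(ℂ, ℂ)) n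
      (fun y ↦ TotalSpace.mk' ℂ y (frame x y : L y)) (trivializationAt ℂ L x).baseSet := by
  rw [(trivializationAt ℂ L x).contMDiffOn_section_baseSet_iff]
  exact (contMDiffOn_const (c := (1 : ℂ))).congr fun y hy ↦ fiberVar_frame hy

section ConnectionForm

variable [∀ x, IsTopologicalAddGroup (L x)] [∀ x, ContinuousSMul ℂ (L x)]

/-- The connection form of `D` in the local frame `frame x`, that is, the form `θ` such that
`D (frame x) = θ ⊗ frame x` over the domain of the preferred trivialization at `x`. -/
def connForm (D : CovariantDerivative 𝓘(ℂ, V) ℂ L) (x y : M) : TangentSpace 𝓘(ℂ, V) y →L[ℂ] ℂ :=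
  (trivializationAt ℂ L x).continuousLinearMapAt ℂ y ∘L D (frame x) y

lemma connForm_apply (D : CovariantDerivative 𝓘(ℂ, V) ℂ L)
    (hy : y ∈ (trivializationAt ℂ L x).baseSet) (v : TangentSpace 𝓘(ℂ, V) y) :
    connForm D x y v = fiberVar x (TotalSpace.mk' ℂ y (D (frame x) y v)) :=
  congrFun ((trivializationAt ℂ L x).coe_linearMapAt_of_mem hy) (D (frame x) y v)

end ConnectionForm

variable [ContMDiffVectorBundle 1 ℂ L 𝓘(ℂ, V)]

lemma tangentSplit_generatorAt (hy : y ∈ (trivializationAt ℂ L x).baseSet) (l : L y) :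
    tangentSplit 𝓘(ℂ, V) x (TotalSpace.mk' ℂ y l) (generatorAt V y l) =
      (0, fiberVar x (TotalSpace.mk' ℂ y l)) := by
  have hexp : HasDerivAt (fun t : ℂ ↦ fiberVar x (TotalSpace.mk' ℂ y (Complex.exp t • l)))
      (fiberVar x (TotalSpace.mk' ℂ y l)) 0 := by
    simp only [fiberVar_smul hy, smul_eq_mul]
    simpa using (Complex.hasDerivAt_exp 0).mul_const (fiberVar x (TotalSpace.mk' ℂ y l))
  refine (tangentSplit_mfderiv_fiberCurve hy hexp (by simp) 1).trans ?_
  rw [one_smul]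

lemma tangentSplit_verticalLift (hy : y ∈ (trivializationAt ℂ L x).baseSet) (l v : L y) :
    tangentSplit 𝓘(ℂ, V) x (TotalSpace.mk' ℂ y l) (verticalLift V y l v) =
      (0, fiberVar x (TotalSpace.mk' ℂ y v)) := by
  have hsymm (z : ℂ) : fiberVar x (TotalSpace.mk' ℂ y ((fiberCoord (L := L) y).symm z)) =
      z * fiberVar x (TotalSpace.mk' ℂ y ((fiberCoord (L := L) y).symm 1)) := by
    rw [← smul_eq_mul, ← fiberVar_smul hy, ← map_smul, smul_eq_mul, mul_one]
  have hline : HasDerivAt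
      (fun z : ℂ ↦ fiberVar x (TotalSpace.mk' ℂ y (l + (fiberCoord y).symm z)))
      (fiberVar x (TotalSpace.mk' ℂ y ((fiberCoord (L := L) y).symm 1))) 0 := by
    have hadd (z : ℂ) := (fiberVar_add (𝕜 := ℂ) hy l _).trans (congrArg (_ + ·) (hsymm z))
    simpa only [hadd, id, one_mul] using
      ((hasDerivAt_id (0 : ℂ)).mul_const _).const_add (fiberVar x (TotalSpace.mk' ℂ y l))
  refine (tangentSplit_mfderiv_fiberCurve hy hline (by simp) (fiberCoord y v)).trans ?_
  rw [smul_eq_mul, ← hsymm, ContinuousLinearEquiv.symm_apply_apply]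

lemma mdifferentiableAt_frame (hy : y ∈ (trivializationAt ℂ L x).baseSet) :
    MDifferentiableAt 𝓘(ℂ, V) (𝓘(ℂ, V).prod 𝓘(ℂ, ℂ))
      (fun y ↦ TotalSpace.mk' ℂ y (frame x y : L y)) y :=
  ((contMDiffOn_frame 1 x).contMDiffAt ((trivializationAt ℂ L x).open_baseSet.mem_nhds hy)
    ).mdifferentiableAt one_ne_zero

variable [∀ x, IsTopologicalAddGroup (L x)] [∀ x, ContinuousSMul ℂ (L x)]

lemma fiberVar_covariantDerivative (D : CovariantDerivative 𝓘(ℂ, V) ℂ L)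
    (hy : y ∈ (trivializationAt ℂ L x).baseSet) {σ : ∀ y, L y}
    (hσ : MDifferentiableAt 𝓘(ℂ, V) (𝓘(ℂ, V).prod 𝓘(ℂ, ℂ)) (fun y ↦ TotalSpace.mk' ℂ y (σ y)) y)
    (v : TangentSpace 𝓘(ℂ, V) y) :
    fiberVar x (TotalSpace.mk' ℂ y (D σ y v)) =
      fiberVar x (TotalSpace.mk' ℂ y (σ y)) * connForm D x y v +
        mvfderiv 𝓘(ℂ, V) (fun y ↦ fiberVar x (TotalSpace.mk' ℂ y (σ y))) y v := by
  have hcoord : MDifferentiableAt 𝓘(ℂ, V) 𝓘(ℂ, ℂ)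
      (fun y ↦ fiberVar x (TotalSpace.mk' ℂ y (σ y))) y :=
    MDifferentiableAt.comp (g := fiberVar (E := L) x) y (mdifferentiableAt_fiberVar hy) hσ
  have hframe : MDifferentiableAt 𝓘(ℂ, V) (𝓘(ℂ, V).prod 𝓘(ℂ, ℂ))
      (fun y ↦ TotalSpace.mk' ℂ y (frame x y : L y)) y := mdifferentiableAt_frame hy
  have hσ_frame : D σ y = D ((fun y ↦ fiberVar x (TotalSpace.mk' ℂ y (σ y))) • frame x) y := by
    refine D.isCovariantDerivativeOnUniv.congr_of_eventuallyEq hσ (hcoord.smul_section hframe)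
      Filter.univ_mem ?_
    filter_upwards [(trivializationAt ℂ L x).open_baseSet.mem_nhds hy] with z hz
    exact (fiberVar_smul_frame hz (σ z)).symm
  rw [hσ_frame, D.isCovariantDerivativeOnUniv.leibniz hframe hcoord, connForm_apply D hy]
  simp only [add_apply, smul_apply, ContinuousLinearMap.smulRight_apply]
  rw [fiberVar_add (𝕜 := ℂ) hy, fiberVar_smul hy, fiberVar_smul hy, fiberVar_frame hy, smul_eq_mul,
    smul_eq_mul, mul_one]

end LineBundle

section Coordinates

variable {V : Type*} [NormedAddCommGroup V] [NormedSpace ℂ V]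
  {M : Type*} [TopologicalSpace M] [ChartedSpace V M]
  {L : M → Type*} [TopologicalSpace (TotalSpace ℂ L)]
  [∀ x, AddCommGroup (L x)] [∀ x, Module ℂ (L x)] [∀ x, TopologicalSpace (L x)]
  [FiberBundle ℂ L] {x y : M}

/-- In the preferred trivialization at `x`, the invariant vector field `e` on `L y \ {0}` is
`z ↦ (v, c z)`: its components are `v` along `M`, and `c` times the infinitesimal generator. -/
def HasCoords (x y : M) (e : AtiyahFiber V L y) (v : TangentSpace 𝓘(ℂ, V) y) (c : ℂ) : Prop :=
  ∀ l : {l : L y // l ≠ 0}, tangentSplit 𝓘(ℂ, V) x (TotalSpace.mk' ℂ y (l : L y)) (e.1 l) =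
    (v, c • fiberVar x (TotalSpace.mk' ℂ y (l : L y)))

lemma HasCoords.add {e e' : AtiyahFiber V L y} {v v' : TangentSpace 𝓘(ℂ, V) y} {c c' : ℂ}
    (h : HasCoords x y e v c) (h' : HasCoords x y e' v' c') :
    HasCoords x y (e + e') (v + v') (c + c') := fun l ↦ by
  refine (map_add (tangentSplit 𝓘(ℂ, V) x _) (e.1 l) (e'.1 l)).trans ?_
  rw [h l, h' l, add_smul]
  rfl

lemma HasCoords.smul {e : AtiyahFiber V L y} {v : TangentSpace 𝓘(ℂ, V) y} {c : ℂ}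
    (h : HasCoords x y e v c) (a : ℂ) : HasCoords x y (a • e) (a • v) (a * c) := fun l ↦ by
  refine (map_smul (tangentSplit 𝓘(ℂ, V) x _) a (e.1 l)).trans ?_
  rw [h l, mul_smul]
  rfl

variable [VectorBundle ℂ ℂ L] [ContMDiffVectorBundle ω ℂ L 𝓘(ℂ, V)]
  {s t : AtiyahSection V L} {X Y : ∀ y : M, TangentSpace 𝓘(ℂ, V) y} {c d : M → ℂ}

lemma tangentSplit_toField (hs : ∀ᶠ y in 𝓝 x, HasCoords x y (s y) (X y) (c y)) {l : L x}
    (hl : l ≠ 0) : ∀ᶠ q in 𝓝 (TotalSpace.mk' ℂ x l),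
      tangentSplit 𝓘(ℂ, V) x q (toField s q) = (X q.proj, c q.proj • fiberVar x q) := by
  have hx := FiberBundle.mem_baseSet_trivializationAt' (F := ℂ) (E := L) x
  have hproj : Filter.Tendsto (TotalSpace.proj : TotalSpace ℂ L → M) (𝓝 (TotalSpace.mk' ℂ x l))
      (𝓝 x) := (FiberBundle.continuous_proj ℂ L).tendsto _
  have hvar := (mdifferentiableAt_fiberVar (I := 𝓘(ℂ, V)) (q := TotalSpace.mk' ℂ x l) hx
    ).continuousAt.eventually_ne (fiberVar_ne_zero hx hl)
  filter_upwards [hproj.eventually hs,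
    hproj.eventually (eventually_mem_baseSet (F := ℂ) (E := L) x), hvar] with q hq hqx hq0
  have hq2 := snd_ne_zero_of_fiberVar hqx hq0
  rw [toField, dif_pos hq2]
  exact hq ⟨q.2, hq2⟩

variable [IsManifold 𝓘(ℂ, V) ω M]

lemma HasCoords.unique {e e' : AtiyahFiber V L x} {v : TangentSpace 𝓘(ℂ, V) x} {c : ℂ}
    (h : HasCoords x x e v c) (h' : HasCoords x x e' v c) : e = e' :=
  Subtype.ext <| funext fun l ↦ (tangentSplit_self x (l : L x) (e.1 l)).symm.trans <|
    ((h l).trans (h' l).symm).trans (tangentSplit_self x (l : L x) (e'.1 l))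

lemma diffAt_of_hasCoords (hs : ∀ᶠ y in 𝓝 x, HasCoords x y (s y) (X y) (c y))
    (hX : VectorFieldDiffAt X x) (hc : MDifferentiableAt 𝓘(ℂ, V) 𝓘(ℂ, ℂ) c x) :
    s.DiffAt x := fun l hl ↦
  (mdifferentiableAt_iff_chartRep (toField s) _).2 <| mdifferentiableAt_of_tangentSplit
    (tangentSplit_toField hs hl) ((mdifferentiableAt_iff_chartRep X x).1 hX)
    (mdifferentiableAt_smul_fiberVar hc l)

variable [∀ x, IsTopologicalAddGroup (L x)] [∀ x, ContinuousSMul ℂ (L x)]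

lemma HasCoords.atiyahBracket [CompleteSpace V]
    (hs : ∀ᶠ y in 𝓝 x, HasCoords x y (s y) (X y) (c y))
    (ht : ∀ᶠ y in 𝓝 x, HasCoords x y (t y) (Y y) (d y))
    (hX : VectorFieldDiffAt X x) (hY : VectorFieldDiffAt Y x)
    (hc : MDifferentiableAt 𝓘(ℂ, V) 𝓘(ℂ, ℂ) c x) (hd : MDifferentiableAt 𝓘(ℂ, V) 𝓘(ℂ, ℂ) d x) :
    HasCoords x x (atiyahBracket s t x) (mlieBracket 𝓘(ℂ, V) X Y x)
      (mvfderiv 𝓘(ℂ, V) d x (X x) - mvfderiv 𝓘(ℂ, V) c x (Y x)) := fun l ↦ by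
  have hs' := tangentSplit_toField hs l.2
  have ht' := tangentSplit_toField ht l.2
  rw [LineBundleAtiyah.atiyahBracket, dif_pos (dscale_mlieBracket s t x
    (diffAt_of_hasCoords hs hX hc) (diffAt_of_hasCoords ht hY hd))]
  refine (tangentSplit_mlieBracket hs' ht' ((mdifferentiableAt_iff_chartRep X x).1 hX)
    ((mdifferentiableAt_iff_chartRep Y x).1 hY) (mdifferentiableAt_smul_fiberVar hc l.1)
    (mdifferentiableAt_smul_fiberVar hd l.1)).trans (Prod.ext rfl ?_)
  rw [mvfderiv_smul_fiberVar hc, mvfderiv_smul_fiberVar hd, hs'.self_of_nhds, ht'.self_of_nhds]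
  simp only [smul_eq_mul]
  ring

lemma hasCoords_generator (hy : y ∈ (trivializationAt ℂ L x).baseSet) :
    HasCoords x y (generator y : AtiyahFiber V L y) 0 1 := fun l ↦
  (tangentSplit_generatorAt hy (l : L y)).trans (by rw [one_smul])

lemma hasCoords_unitSection (u : M → ℂ) (hy : y ∈ (trivializationAt ℂ L x).baseSet) :
    HasCoords x y (unitSection u y : AtiyahFiber V L y) 0 (u y)⁻¹ := by
  have hsmul := (hasCoords_generator (V := V) hy).smul (u y)⁻¹
  rwa [smul_zero, mul_one] at hsmul

lemma tangentSplit_horizontalLiftAt (D : CovariantDerivative 𝓘(ℂ, V) ℂ L)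
    (hy : y ∈ (trivializationAt ℂ L x).baseSet) (l : L y) (v : TangentSpace 𝓘(ℂ, V) y) :
    tangentSplit 𝓘(ℂ, V) x (TotalSpace.mk' ℂ y l) (horizontalLiftAt D y l v) =
      (v, -connForm D x y v • fiberVar x (TotalSpace.mk' ℂ y l)) := by
  have hsection := mdifferentiableAt_localSection (V := V) y l
  have hlift : tangentSplit 𝓘(ℂ, V) x (TotalSpace.mk' ℂ y l) (dLocalSection V y l v) =
      (v, mvfderiv 𝓘(ℂ, V) (fun z ↦ fiberVar x (TotalSpace.mk' ℂ z (localSection y l z))) y v) :=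
    (tangentSplit_mfderiv (q := TotalSpace.mk' ℂ y l) hy hsection
      (by rw [localSection_self]) v).trans
      (Prod.ext (congrArg (fun A : V →L[ℂ] V ↦ A v) (mfderiv_id (I := 𝓘(ℂ, V)) (x := y))) rfl)
  refine (map_sub (tangentSplit 𝓘(ℂ, V) x (TotalSpace.mk' ℂ y l)) (dLocalSection V y l v)
    (verticalLift V y l (D (localSection y l) y v))).trans ?_
  rw [hlift, tangentSplit_verticalLift hy, fiberVar_covariantDerivative D hy hsection,
    localSection_self]
  exact Prod.ext (sub_zero _) (by simp only [Prod.snd_sub, smul_eq_mul]; ring)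

lemma hasCoords_horizontal (D : CovariantDerivative 𝓘(ℂ, V) ℂ L)
    (hy : y ∈ (trivializationAt ℂ L x).baseSet) (v : TangentSpace 𝓘(ℂ, V) y) :
    HasCoords x y (horizontal D y v) v (-connForm D x y v) := fun l ↦
  tangentSplit_horizontalLiftAt D hy (l : L y) v

end Coordinates

section Curvature

variable {V : Type*} [NormedAddCommGroup V] [NormedSpace ℂ V]
  {M : Type*} [TopologicalSpace M] [ChartedSpace V M] [IsManifold 𝓘(ℂ, V) ω M]
  {L : M → Type*} [TopologicalSpace (TotalSpace ℂ L)]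
  [∀ x, AddCommGroup (L x)] [∀ x, Module ℂ (L x)] [∀ x, TopologicalSpace (L x)]
  [∀ x, IsTopologicalAddGroup (L x)] [∀ x, ContinuousSMul ℂ (L x)]
  [FiberBundle ℂ L] [VectorBundle ℂ ℂ L]
  {D : CovariantDerivative 𝓘(ℂ, V) ℂ L} {x y : M} {X Y : ∀ y : M, TangentSpace 𝓘(ℂ, V) y}

/-- The coordinate expression of the connection form `connForm D x` in the preferred
trivialization of the tangent bundle at `x`. -/
def connCoeff (D : CovariantDerivative 𝓘(ℂ, V) ℂ L) (x y : M) : V →L[ℂ] ℂ :=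
  connForm D x y ∘L (trivializationAt V (TangentSpace 𝓘(ℂ, V)) x).symmL ℂ y

lemma connForm_eq_connCoeff (D : CovariantDerivative 𝓘(ℂ, V) ℂ L)
    (hy : y ∈ (chartAt V x).source) (v : TangentSpace 𝓘(ℂ, V) y) :
    connForm D x y v = connCoeff D x y (mvfderiv 𝓘(ℂ, V) (extChartAt 𝓘(ℂ, V) x) y v) := by
  have hbase : y ∈ (trivializationAt V (TangentSpace 𝓘(ℂ, V)) x).baseSet := by simpa using hy
  refine congrArg (connForm D x y) (?_ : v = _)
  rw [← trivializationAt_tangent_snd hy,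
    ← Trivialization.continuousLinearMapAt_apply_of_mem (R := ℂ) _ hbase]
  exact (Trivialization.symmL_continuousLinearMapAt _ hbase v).symm

lemma connForm_self (D : CovariantDerivative 𝓘(ℂ, V) ℂ L) (x : M) (v : TangentSpace 𝓘(ℂ, V) x) :
    connForm D x x v = connCoeff D x x v :=
  (connForm_eq_connCoeff D (mem_chart_source V x) v).trans
    (congrArg _ (mvfderiv_extChartAt_self x v))

lemma connForm_eventuallyEq (D : CovariantDerivative 𝓘(ℂ, V) ℂ L) (x : M)
    (X : ∀ y : M, TangentSpace 𝓘(ℂ, V) y) :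
    (fun y ↦ connForm D x y (X y)) =ᶠ[𝓝 x] fun y ↦ connCoeff D x y (chartRep 𝓘(ℂ, V) x X y) :=
  Filter.eventually_of_mem (chart_source_mem_nhds V x) fun y hy ↦ connForm_eq_connCoeff D hy (X y)

/-- The exterior derivative at `x` of the connection form `connForm D x`. -/
def dConnForm (D : CovariantDerivative 𝓘(ℂ, V) ℂ L) (x : M) (v w : TangentSpace 𝓘(ℂ, V) x) : ℂ :=
  mvfderiv 𝓘(ℂ, V) (connCoeff D x) x v w - mvfderiv 𝓘(ℂ, V) (connCoeff D x) x w v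

variable [ContMDiffVectorBundle ω ℂ L 𝓘(ℂ, V)]

lemma mdifferentiableAt_covariantDerivative_frame (hD : IsHolomorphicConnection D) (x : M) :
    MDifferentiableAt 𝓘(ℂ, V) (𝓘(ℂ, V).prod 𝓘(ℂ, V →L[ℂ] ℂ)) (fun y ↦ TotalSpace.mk'
      (V →L[ℂ] ℂ) (E := fun y ↦ TangentSpace 𝓘(ℂ, V) y →L[ℂ] L y) y (D (frame x) y)) x :=
  (((hD _ (trivializationAt ℂ L x).open_baseSet).contMDiff (σ := frame x)
    (contMDiffOn_frame (ω + 1) x)).contMDiffAt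
      (eventually_mem_baseSet (F := ℂ) (E := L) x)).mdifferentiableAt (by simp)

lemma mdifferentiableAt_connCoeff (hD : IsHolomorphicConnection D) (x : M) :
    MDifferentiableAt 𝓘(ℂ, V) 𝓘(ℂ, V →L[ℂ] ℂ) (connCoeff D x) x :=
  ((mdifferentiableAt_hom_bundle _).1 (mdifferentiableAt_covariantDerivative_frame hD x)).2

lemma mdifferentiableAt_connForm (hD : IsHolomorphicConnection D) (hX : VectorFieldDiffAt X x) :
    MDifferentiableAt 𝓘(ℂ, V) 𝓘(ℂ, ℂ) (fun y ↦ connForm D x y (X y)) x :=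
  (connForm_eventuallyEq D x X).mdifferentiableAt_iff.2 <|
    (mdifferentiableAt_connCoeff hD x).clm_apply ((mdifferentiableAt_iff_chartRep X x).1 hX)

lemma mvfderiv_connForm (hD : IsHolomorphicConnection D) (hX : VectorFieldDiffAt X x)
    (v : TangentSpace 𝓘(ℂ, V) x) :
    mvfderiv 𝓘(ℂ, V) (fun y ↦ connForm D x y (X y)) x v =
      mvfderiv 𝓘(ℂ, V) (connCoeff D x) x v (X x) +
        connForm D x x (mvfderiv 𝓘(ℂ, V) (chartRep 𝓘(ℂ, V) x X) x v) := by
  rw [mvfderiv_congr (connForm_eventuallyEq D x X), mvfderiv_clm_apply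
    (mdifferentiableAt_connCoeff hD x) ((mdifferentiableAt_iff_chartRep X x).1 hX), chartRep,
    mvfderiv_extChartAt_self]
  exact congrArg _ (connForm_self D x _).symm

lemma dConnForm_eq_mlieBracket (hD : IsHolomorphicConnection D) (hX : VectorFieldDiffAt X x)
    (hY : VectorFieldDiffAt Y x) :
    dConnForm D x (X x) (Y x) =
      mvfderiv 𝓘(ℂ, V) (fun y ↦ connForm D x y (Y y)) x (X x) -
        mvfderiv 𝓘(ℂ, V) (fun y ↦ connForm D x y (X y)) x (Y x) -
        connForm D x x (mlieBracket 𝓘(ℂ, V) X Y x) := by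
  rw [mvfderiv_connForm hD hX, mvfderiv_connForm hD hY, mlieBracket_eq_chartRep
    ((mdifferentiableAt_iff_chartRep X x).1 hX) ((mdifferentiableAt_iff_chartRep Y x).1 hY),
    dConnForm]
  linear_combination (map_sub (connForm D x x)
    (mvfderiv 𝓘(ℂ, V) (chartRep 𝓘(ℂ, V) x Y) x (X x) : TangentSpace 𝓘(ℂ, V) x)
    (mvfderiv 𝓘(ℂ, V) (chartRep 𝓘(ℂ, V) x X) x (Y x)))

lemma fiberCoord_covariantDerivative_covariantDerivative (hD : IsHolomorphicConnection D)
    (hX : VectorFieldDiffAt X x) (v : TangentSpace 𝓘(ℂ, V) x) :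
    fiberCoord x (D (fun y ↦ D (frame x) y (X y)) x v) =
      connForm D x x (X x) * connForm D x x v +
        mvfderiv 𝓘(ℂ, V) (fun y ↦ connForm D x y (X y)) x v := by
  have hx := FiberBundle.mem_baseSet_trivializationAt' (F := ℂ) (E := L) x
  refine (fiberVar_covariantDerivative D hx
    ((mdifferentiableAt_covariantDerivative_frame hD x).clm_bundle_apply hX) v).trans ?_
  rw [connForm_apply D hx (X x), mvfderiv_congr]
  filter_upwards [eventually_mem_baseSet (F := ℂ) (E := L) x] with y hy
  exact (connForm_apply D hy (X y)).symm

lemma curvatureForm_eq_dConnForm (hD : IsHolomorphicConnection D)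
    (v w : TangentSpace 𝓘(ℂ, V) x) : curvatureForm D x v w = dConnForm D x v w := by
  have hext (v : TangentSpace 𝓘(ℂ, V) x) : VectorFieldDiffAt (FiberBundle.extend V v) x :=
    FiberBundle.mdifferentiableAt_extend 𝓘(ℂ, V) V v
  have hvalue (v : TangentSpace 𝓘(ℂ, V) x) : FiberBundle.extend V v x = v := by simp
  have hframe (v : TangentSpace 𝓘(ℂ, V) x) :
      fiberCoord x (D (frame x) x v) = connForm D x x v :=
    (connForm_apply D (FiberBundle.mem_baseSet_trivializationAt' x) v).symm
  have hdConnForm := dConnForm_eq_mlieBracket hD (hext v) (hext w)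
  rw [hvalue, hvalue] at hdConnForm
  change fiberCoord x (curvatureOperator D (FiberBundle.extend V v) (FiberBundle.extend V w)
    (frame x) x) = _
  rw [curvatureOperator, map_sub, map_sub, hvalue, hvalue,
    fiberCoord_covariantDerivative_covariantDerivative hD (hext v),
    fiberCoord_covariantDerivative_covariantDerivative hD (hext w), hframe, hvalue, hvalue,
    hdConnForm]
  ring

lemma eventually_hasCoords_horizontal (D : CovariantDerivative 𝓘(ℂ, V) ℂ L) (x : M)
    (X : ∀ y : M, TangentSpace 𝓘(ℂ, V) y) :
    ∀ᶠ y in 𝓝 x, HasCoords x y (horizontal D y (X y)) (X y) (-connForm D x y (X y)) :=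
  (eventually_mem_baseSet (F := ℂ) (E := L) x).mono fun y hy ↦ hasCoords_horizontal D hy (X y)

variable [CompleteSpace V]

lemma atiyahBracket_horizontal_horizontal (hD : IsHolomorphicConnection D)
    (hX : VectorFieldDiffAt X x) (hY : VectorFieldDiffAt Y x) :
    atiyahBracket (fun y ↦ horizontal D y (X y)) (fun y ↦ horizontal D y (Y y)) x =
      horizontal D x (mlieBracket 𝓘(ℂ, V) X Y x) +
        -curvatureForm D x (X x) (Y x) • generator x := by
  have hx := FiberBundle.mem_baseSet_trivializationAt' (F := ℂ) (E := L) x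
  have hbracket := HasCoords.atiyahBracket (eventually_hasCoords_horizontal D x X)
    (eventually_hasCoords_horizontal D x Y) hX hY (mdifferentiableAt_connForm hD hX).neg
    (mdifferentiableAt_connForm hD hY).neg
  have hsum := (hasCoords_horizontal D hx (mlieBracket 𝓘(ℂ, V) X Y x)).add
    ((hasCoords_generator (V := V) hx).smul (-curvatureForm D x (X x) (Y x)))
  rw [smul_zero, add_zero, mul_one] at hsum
  have hneg (Z : ∀ y : M, TangentSpace 𝓘(ℂ, V) y) (v : TangentSpace 𝓘(ℂ, V) x) :
      mvfderiv 𝓘(ℂ, V) (fun y ↦ -connForm D x y (Z y)) x v =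
        -mvfderiv 𝓘(ℂ, V) (fun y ↦ connForm D x y (Z y)) x v :=
    congrArg (fun A : V →L[ℂ] ℂ ↦ A v) mvfderiv_neg
  rw [hneg, hneg] at hbracket
  refine hbracket.unique ?_
  convert hsum using 1
  rw [curvatureForm_eq_dConnForm hD, dConnForm_eq_mlieBracket hD hX hY]
  ring

lemma atiyahBracket_horizontal_unitSection (hD : IsHolomorphicConnection D) {u : M → ℂ}
    (hu : MDifferentiableAt 𝓘(ℂ, V) 𝓘(ℂ, ℂ) u x) (hu0 : u x ≠ 0) (hX : VectorFieldDiffAt X x) :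
    atiyahBracket (fun y ↦ horizontal D y (X y)) (unitSection u) x =
      -((u x)⁻¹ * mvfderiv 𝓘(ℂ, V) u x (X x)) • unitSection u x := by
  have hx := FiberBundle.mem_baseSet_trivializationAt' (F := ℂ) (E := L) x
  have hunit : ∀ᶠ y in 𝓝 x, HasCoords x y (unitSection u y : AtiyahFiber V L y)
      ((0 : ∀ y : M, TangentSpace 𝓘(ℂ, V) y) y) (u y)⁻¹ :=
    (eventually_mem_baseSet (F := ℂ) (E := L) x).mono fun y hy ↦ hasCoords_unitSection u hy
  have hbracket := HasCoords.atiyahBracket (eventually_hasCoords_horizontal D x X) hunit hX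
    (mdifferentiableAt_zeroSection ..) (mdifferentiableAt_connForm hD hX).neg
    (mdifferentiableAt_inv hu hu0)
  have hsmul := (hasCoords_unitSection (V := V) u hx).smul
    (-((u x)⁻¹ * mvfderiv 𝓘(ℂ, V) u x (X x)))
  rw [mlieBracket_zero_right, mvfderiv_inv hu hu0, Pi.zero_apply, map_zero, sub_zero] at hbracket
  rw [smul_zero] at hsmul
  exact hbracket.unique hsmul

end Curvature

end LineBundleAtiyah

end

theorem proposition1p2_general
    {V : Type*} [NormedAddCommGroup V] [NormedSpace ℂ V] [CompleteSpace V]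
    {M : Type*} [TopologicalSpace M] [ChartedSpace V M] [IsManifold 𝓘(ℂ, V) ω M]
    {L : M → Type*} [TopologicalSpace (TotalSpace ℂ L)]
    [∀ x, AddCommGroup (L x)] [∀ x, Module ℂ (L x)] [∀ x, TopologicalSpace (L x)]
    [∀ x, IsTopologicalAddGroup (L x)] [∀ x, ContinuousSMul ℂ (L x)]
    [FiberBundle ℂ L] [VectorBundle ℂ ℂ L] [ContMDiffVectorBundle ω ℂ L 𝓘(ℂ, V)]
    (D : CovariantDerivative 𝓘(ℂ, V) ℂ L) (hD : IsHolomorphicConnection D)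
    (u : M → ℂ) (hu : MDifferentiable 𝓘(ℂ, V) 𝓘(ℂ, ℂ) u) (hu0 : ∀ x, u x ≠ 0)
    (g : ∀ x : M, TangentSpace 𝓘(ℂ, V) x →L[ℂ] TangentSpace 𝓘(ℂ, V) x →L[ℂ] ℂ)
    (h : ∀ x : M, TangentSpace 𝓘(ℂ, V) x →ₗ[ℂ]
      TangentSpace 𝓘(ℂ, V) x →ₗ[ℂ] TangentSpace 𝓘(ℂ, V) x)
    (γ : ∀ x : M, AtiyahFiber V L x →ₗ[ℂ] TangentSpace 𝓘(ℂ, V) x)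
    (nab : RhoConnectionTM V L) (nabE : RhoConnectionE V L)
    (horizontal_horizontal : ∀ (x : M) (v : TangentSpace 𝓘(ℂ, V) x)
      (Y : ∀ y : M, TangentSpace 𝓘(ℂ, V) y), VectorFieldDiffAt Y x →
      nabE.toFun (fun y ↦ horizontal D y (Y y)) x (horizontal D x v) =
        horizontal D x (nab.toFun Y x (horizontal D x v) + h x (γ x (horizontal D x v)) (Y x))
          - g x (γ x (horizontal D x v)) (Y x) • unitSection u x)
    (horizontal_unit : ∀ (x : M) (v : TangentSpace 𝓘(ℂ, V) x),
      nabE.toFun (unitSection u) x (horizontal D x v) = horizontal D x (γ x (horizontal D x v)))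
    (unit_horizontal : ∀ (x : M) (X : ∀ y : M, TangentSpace 𝓘(ℂ, V) y), VectorFieldDiffAt X x →
      nabE.toFun (fun y ↦ horizontal D y (X y)) x (unitSection u x) =
        horizontal D x (nab.toFun X x (unitSection u x) + h x (γ x (unitSection u x)) (X x))
          - g x (γ x (unitSection u x)) (X x) • unitSection u x) :
    (∀ (x : M) (X Y : ∀ y : M, TangentSpace 𝓘(ℂ, V) y),
      VectorFieldDiffAt X x → VectorFieldDiffAt Y x →
      rhoTorsion nabE (fun y ↦ horizontal D y (X y)) (fun y ↦ horizontal D y (Y y)) x =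
        horizontal D x (nab.toFun Y x (horizontal D x (X x)) - nab.toFun X x (horizontal D x (Y x))
          - VectorField.mlieBracket 𝓘(ℂ, V) X Y x
          + h x (γ x (horizontal D x (X x))) (Y x) - h x (γ x (horizontal D x (Y x))) (X x))
        + (u x * curvatureForm D x (X x) (Y x)
          - g x (γ x (horizontal D x (X x))) (Y x)
          + g x (γ x (horizontal D x (Y x))) (X x)) • unitSection u x) ∧
    (∀ (x : M) (X : ∀ y : M, TangentSpace 𝓘(ℂ, V) y), VectorFieldDiffAt X x →
      rhoTorsion nabE (fun y ↦ horizontal D y (X y)) (unitSection u) x =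
        horizontal D x (γ x (horizontal D x (X x)) - nab.toFun X x (unitSection u x)
          - h x (γ x (unitSection u x)) (X x))
        + ((u x)⁻¹ * mvfderiv 𝓘(ℂ, V) u x (X x)
          + g x (γ x (unitSection u x)) (X x)) • unitSection u x) := by
  refine ⟨fun x X Y hX hY ↦ ?_, fun x X hX ↦ ?_⟩
  · have hgen : generator (V := V) (L := L) x = u x • unitSection u x := by
      rw [unitSection, smul_inv_smul₀ (hu0 x)]
    rw [rhoTorsion, horizontal_horizontal x (X x) Y hY, horizontal_horizontal x (Y x) X hX,
      atiyahBracket_horizontal_horizontal hD hX hY, hgen]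
    simp only [map_add, map_sub]
    module
  · rw [rhoTorsion, horizontal_unit, unit_horizontal x X hX,
      atiyahBracket_horizontal_unitSection hD (hu x) (hu0 x) hX]
    simp only [map_add, map_sub]
    module

theorem proposition1p2
    {V : Type*} [NormedAddCommGroup V] [NormedSpace ℂ V] [FiniteDimensional ℂ V] [CompleteSpace V]
    {M : Type*} [TopologicalSpace M] [ChartedSpace V M] [IsManifold 𝓘(ℂ, V) ω M]
    {L : M → Type*} [TopologicalSpace (TotalSpace ℂ L)]
    [∀ x, AddCommGroup (L x)] [∀ x, Module ℂ (L x)] [∀ x, TopologicalSpace (L x)]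
    [∀ x, IsTopologicalAddGroup (L x)] [∀ x, ContinuousSMul ℂ (L x)]
    [FiberBundle ℂ L] [VectorBundle ℂ ℂ L] [ContMDiffVectorBundle ω ℂ L 𝓘(ℂ, V)]
    (D : CovariantDerivative 𝓘(ℂ, V) ℂ L) (hD : IsHolomorphicConnection D)
    (u : M → ℂ) (hu : ContMDiff 𝓘(ℂ, V) 𝓘(ℂ, ℂ) ω u) (hu0 : ∀ x, u x ≠ 0)
    (g : HolomorphicMetric V M)
    (h : ∀ x : M, TangentSpace 𝓘(ℂ, V) x →ₗ[ℂ]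
      TangentSpace 𝓘(ℂ, V) x →ₗ[ℂ] TangentSpace 𝓘(ℂ, V) x)
    (γ : ∀ x : M, AtiyahFiber V L x →ₗ[ℂ] TangentSpace 𝓘(ℂ, V) x)
    (nab : RhoConnectionTM V L) (nabE : RhoConnectionE V L)
    (hnab : IsTildeConnection D u g h γ nab nabE) :
    (∀ (x : M) (X Y : ∀ y : M, TangentSpace 𝓘(ℂ, V) y),
      VectorFieldDiffAt X x → VectorFieldDiffAt Y x →
      rhoTorsion nabE (fun y ↦ horizontal D y (X y)) (fun y ↦ horizontal D y (Y y)) x =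
        horizontal D x ((inducedConnection D nab).torsion x (X x) (Y x)
          + h x (γ x (horizontal D x (X x))) (Y x) - h x (γ x (horizontal D x (Y x))) (X x))
        + (u x * curvatureForm D x (X x) (Y x)
          - g.inner x (γ x (horizontal D x (X x))) (Y x)
          + g.inner x (γ x (horizontal D x (Y x))) (X x)) • unitSection u x) ∧
    (∀ (x : M) (X : ∀ y : M, TangentSpace 𝓘(ℂ, V) y), VectorFieldDiffAt X x →
      rhoTorsion nabE (fun y ↦ horizontal D y (X y)) (unitSection u) x =
        horizontal D x (γ x (horizontal D x (X x)) - nab.toFun X x (unitSection u x)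
          - h x (γ x (unitSection u x)) (X x))
        + ((u x)⁻¹ * mvfderiv 𝓘(ℂ, V) u x (X x)
          + g.inner x (γ x (unitSection u x)) (X x)) • unitSection u x) := by
  obtain ⟨hXY, hX1⟩ := proposition1p2_general D hD u (hu.mdifferentiable (by simp)) hu0 g.inner h γ
    nab nabE hnab.horizontal_horizontal hnab.horizontal_unit hnab.unit_horizontal
  refine ⟨fun x X Y hX hY ↦ ?_, hX1⟩
  rw [(inducedConnection D nab).torsion_apply hX hY]
  exact hXY x X Y hX hY
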